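/- **Lemma (weak comparison principle).** Let $N\ge 1$, let $\Omega\subset\mathbb{R}^N$ be a bounded open set (for instance a bounded $C^2$ domain), and let $p>1$, $\gamma>0$, $\vartheta\ge 0$, $c>0$ and $\alpha\in(0,1)$. Let $u_1,u_2\in C^{1,\alpha}_{\rm loc}(\Omega)\cap L^\infty(\Omega)$ be such that $$ \begin{cases} -\Delta_p u_1+\vartheta|\nabla u_1|^p+\vartheta\le \dfrac{c}{u_1^\gamma} & \text{in }\Omega,\\[1ex] -\Delta_p u_2+\vartheta|\nabla u_2|^p+\vartheta\ge \dfrac{c}{u_2^\gamma} & \text{in }\Omega,\\[1ex] u_1,u_2>0 & \text{in }\Omega,\\ u_1\le u_2 & \text{on }\partial\Omega. \end{cases} $$ Here the differential inequalities are understood in the weak sense, that is, for every $\varphi\in C^1_c(\Omega)$ with $\varphi\ge 0$, $$ \int_\Omega |\nabla u_1|^{p-2}\langle\nabla u_1,\nabla\varphi\rangle+\vartheta\int_\Omega|\nabla u_1|^p\varphi+\vartheta\int_\Omega\varphi\le\int_\Omega\frac{c\,\varphi}{u_1^\gamma}, $$ and the same with $\ge$ for $u_2$. The positivity $u_i>0$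 means $\operatorname{ess\,inf}_K u_i>0$ for every compact $K\subset\Omega$. The boundary inequality $u_1\le u_2$ on $\partial\Omega$ means $(u_1-u_2-\varepsilon)^+\in W^{1,p}_0(\Omega)$ for every $\varepsilon>0$, where $W^{1,p}_0(\Omega)$ is the closure of $C^\infty_c(\Omega)$ in $W^{1,p}(\Omega)$. If $\vartheta>0$, assume further that $$ u_1\le\left(\frac{c}{\vartheta}\right)^{1/\gamma}\quad\text{in }\Omega. $$ Then $u_1\le u_2$ in $\Omega$. -/

import Mathlib

open MeasureTheory Filter Topology
open scoped ContDiff ENNReal Gradient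

/-- Test functions of class `C^k` with compact support in `Ω`, extended by zero to the whole
space. -/
def IsTestFunction {N : ℕ} (k : ℕ∞) (Ω : Set (EuclideanSpace ℝ (Fin N)))
    (φ : EuclideanSpace ℝ (Fin N) → ℝ) : Prop :=
  ContDiff ℝ (k : WithTop ℕ∞) φ ∧ HasCompactSupport φ ∧ tsupport φ ⊆ Ω

/-- `G` is the weak (distributional) gradient of `f` in the open set `Ω`:
`∫_Ω f ∇φ = - ∫_Ω φ G` for all `φ ∈ C_c^∞(Ω)`. -/
def HasWeakGradient {N : ℕ} (Ω : Set (EuclideanSpace ℝ (Fin N)))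
    (f : EuclideanSpace ℝ (Fin N) → ℝ)
    (G : EuclideanSpace ℝ (Fin N) → EuclideanSpace ℝ (Fin N)) : Prop :=
  LocallyIntegrableOn f Ω volume ∧ LocallyIntegrableOn G Ω volume ∧
    ∀ φ : EuclideanSpace ℝ (Fin N) → ℝ, IsTestFunction ⊤ Ω φ →
      ∫ x in Ω, f x • ∇ φ x = - ∫ x in Ω, φ x • G x

/-- The space `W^{1,p}_0(Ω)`: the closure of `C_c^∞(Ω)` in `W^{1,p}(Ω)`. That is, `f` and its weak
gradient are in `L^p(Ω)`, and some sequence of `C_c^∞(Ω)` functions converges to `f` in `L^p(Ω)`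
together with the gradients. -/
def MemW1pZero {N : ℕ} (p : ℝ) (Ω : Set (EuclideanSpace ℝ (Fin N)))
    (f : EuclideanSpace ℝ (Fin N) → ℝ) : Prop :=
  ∃ G : EuclideanSpace ℝ (Fin N) → EuclideanSpace ℝ (Fin N),
    HasWeakGradient Ω f G ∧
    MemLp f (ENNReal.ofReal p) (volume.restrict Ω) ∧
    MemLp G (ENNReal.ofReal p) (volume.restrict Ω) ∧
    ∃ φ : ℕ → EuclideanSpace ℝ (Fin N) → ℝ,
      (∀ n, IsTestFunction ⊤ Ω (φ n)) ∧
      Tendsto (fun n => eLpNorm (fun x => f x - φ n x) (ENNReal.ofReal p) (volume.restrict Ω))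
        atTop (𝓝 0) ∧
      Tendsto (fun n => eLpNorm (fun x => G x - ∇ (φ n) x) (ENNReal.ofReal p)
        (volume.restrict Ω)) atTop (𝓝 0)

/-- `v₁ ≤ v₂` on `∂Ω` in the weak sense: `(v₁ - v₂ - ε)⁺ ∈ W^{1,p}_0(Ω)` for every `ε > 0`. -/
def BoundaryLE {N : ℕ} (p : ℝ) (Ω : Set (EuclideanSpace ℝ (Fin N)))
    (v₁ v₂ : EuclideanSpace ℝ (Fin N) → ℝ) : Prop :=
  ∀ ε : ℝ, 0 < ε → MemW1pZero p Ω (fun x => max (v₁ x - v₂ x - ε) 0)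

/-- `u ∈ C^{1,α}_loc(Ω)`: `u` is `C^1` in the open set `Ω` and its gradient is `α`-Hölder on every
compact subset of `Ω`. -/
def IsC1HolderLoc {N : ℕ} (α : ℝ) (Ω : Set (EuclideanSpace ℝ (Fin N)))
    (u : EuclideanSpace ℝ (Fin N) → ℝ) : Prop :=
  ContDiffOn ℝ 1 u Ω ∧
    ∀ K : Set (EuclideanSpace ℝ (Fin N)), IsCompact K → K ⊆ Ω →
      ∃ C : ℝ, ∀ x ∈ K, ∀ y ∈ K, ‖∇ u x - ∇ u y‖ ≤ C * ‖x - y‖ ^ α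

/-- `u > 0` in `Ω`: the essential infimum of `u` over every compact subset of `Ω` is positive. -/
def EssPositive {N : ℕ} (Ω : Set (EuclideanSpace ℝ (Fin N)))
    (u : EuclideanSpace ℝ (Fin N) → ℝ) : Prop :=
  ∀ K : Set (EuclideanSpace ℝ (Fin N)), IsCompact K → K ⊆ Ω →
    ∃ δ : ℝ, 0 < δ ∧ ∀ᵐ x ∂(volume.restrict K), δ ≤ u x

/-- `-Δ_p u + ϑ |∇u|^p + ϑ ≤ c / u^γ` in `Ω` in the weak sense, for `u ∈ C^1(Ω)`, `u > 0`. -/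
def IsWeakSubsolution {N : ℕ} (p γ ϑ c : ℝ) (Ω : Set (EuclideanSpace ℝ (Fin N)))
    (u : EuclideanSpace ℝ (Fin N) → ℝ) : Prop :=
  ∀ φ : EuclideanSpace ℝ (Fin N) → ℝ, IsTestFunction 1 Ω φ → (∀ x, 0 ≤ φ x) →
    (∫ x in Ω, ‖∇ u x‖ ^ (p - 2) * inner ℝ (∇ u x) (∇ φ x)) +
        ϑ * (∫ x in Ω, ‖∇ u x‖ ^ p * φ x) + ϑ * (∫ x in Ω, φ x)
      ≤ ∫ x in Ω, c / u x ^ γ * φ x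

/-- `-Δ_p u + ϑ |∇u|^p + ϑ ≥ c / u^γ` in `Ω` in the weak sense, for `u ∈ C^1(Ω)`, `u > 0`. -/
def IsWeakSupersolution {N : ℕ} (p γ ϑ c : ℝ) (Ω : Set (EuclideanSpace ℝ (Fin N)))
    (u : EuclideanSpace ℝ (Fin N) → ℝ) : Prop :=
  ∀ φ : EuclideanSpace ℝ (Fin N) → ℝ, IsTestFunction 1 Ω φ → (∀ x, 0 ≤ φ x) →
    ∫ x in Ω, c / u x ^ γ * φ x ≤
      (∫ x in Ω, ‖∇ u x‖ ^ (p - 2) * inner ℝ (∇ u x) (∇ φ x)) +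
        ϑ * (∫ x in Ω, ‖∇ u x‖ ^ p * φ x) + ϑ * (∫ x in Ω, φ x)

/-! The gradient term is removed by the substitution `v = g(u)` with `g'(t) = exp (-ϑ t / (p - 1))`.
Since the `p`-Laplacian is homogeneous of degree `p - 1`, testing the inequality for `u` with `φ exp
(-ϑ u)` gives an inequality for `v` with `-Δ_p v` alone on one side and `f(u) = exp (-ϑ u) (c / u^γ
- ϑ)` on the other. The bound `u₁ ≤ (c/ϑ)^{1/γ}` places the comparison where the second factor of
`f` is nonnegative, and there `f` is strictly decreasing. So `f(u₁) < f(u₂)` wherever `u₁ > u₂`,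
while monotonicity of `ξ ↦ |ξ|^{p-2} ξ` pushes in the opposite direction.

The difficulty is at the boundary: neither `∇u₁` nor `∇u₂` is known to be in `L^p(Ω)`, so `(v₁ - v₂
- κ)⁺` cannot simply be used as a test function. It is squared, to be of class `C^1`, and multiplied
by `η ^ p` with `η` a compactly supported cutoff. Two facts control the error containing `∇η`. The
approximants of `(u₁ - u₂ - ε)⁺` in `W^{1,p}_0`, composed with a step function, give cutoffs with
bounded energy on `Ω` and vanishing energy on `E = {u₁ > u₂ + 2ε}` (`MemW1pZero.exists_cutoff`). On
`E`, `u₁` stays away from `0` and `u₂` stays below the cap, so a Caccioppoli inequality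
(`caccioppoli`) bounds the `η ^ p`-weighted energies of `v₁` and `v₂`. Young's inequality with a
small parameter `τ` then makes the error negligible, first as `n → ∞`, then as `τ → 0`
(`sub_le_of_cutoff`). -/

/-- The vector field `ξ ↦ |ξ|^{p-2} ξ` of the `p`-Laplacian. -/
noncomputable def pField {E : Type*} [NormedAddCommGroup E] [NormedSpace ℝ E] (p : ℝ) (ξ : E) : E :=
  ‖ξ‖ ^ (p - 2) • ξ

/-! ### Algebra and monotonicity of the `p`-Laplacian field -/

section pField

variable {E : Type*} [NormedAddCommGroup E] [InnerProductSpace ℝ E] {p : ℝ}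

lemma norm_pField (hp : 1 < p) (ξ : E) : ‖pField p ξ‖ = ‖ξ‖ ^ (p - 1) := by
  rcases eq_or_ne ξ 0 with rfl | h
  · simp [pField, Real.zero_rpow (by linarith : p - 1 ≠ 0)]
  · have h' : 0 < ‖ξ‖ := norm_pos_iff.2 h
    rw [pField, norm_smul, Real.norm_of_nonneg (by positivity)]
    nth_rewrite 2 [← Real.rpow_one ‖ξ‖]
    rw [← Real.rpow_add h']
    congr 1; ring

lemma inner_pField_self (hp : 1 < p) (ξ : E) : inner ℝ (pField p ξ) ξ = ‖ξ‖ ^ p := by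
  rcases eq_or_ne ξ 0 with rfl | h
  · simp [pField, Real.zero_rpow (by linarith : p ≠ 0)]
  · have h' : 0 < ‖ξ‖ := norm_pos_iff.2 h
    rw [pField, real_inner_smul_left, real_inner_self_eq_norm_sq, ← Real.rpow_two,
      ← Real.rpow_add h']
    congr 1; ring

lemma pField_neg (ξ : E) : pField p (-ξ) = -pField p ξ := by
  simp [pField]

lemma pField_smul {a : ℝ} (ha : 0 < a) (ξ : E) :
    pField p (a • ξ) = a ^ (p - 1) • pField p ξ := by
  simp only [pField, norm_smul, Real.norm_of_nonneg ha.le]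
  rw [Real.mul_rpow ha.le (norm_nonneg _), smul_smul, smul_smul]
  congr 1
  have : a ^ (p - 1) = a ^ (p - 2) * a := by
    rw [← Real.rpow_add_one ha.ne']; congr 1; ring
  rw [this]; ring

lemma continuous_pField (hp : 1 < p) : Continuous (pField p : E → E) := by
  rw [continuous_iff_continuousAt]
  intro ξ
  rcases eq_or_ne ξ 0 with rfl | h
  · have h0 : pField p (0 : E) = 0 := by simp [pField]
    rw [ContinuousAt, h0, tendsto_zero_iff_norm_tendsto_zero]
    simp only [norm_pField hp]
    have : Continuous fun ξ : E => ‖ξ‖ ^ (p - 1) :=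
      continuous_norm.rpow_const fun _ => Or.inr (by linarith)
    simpa [Real.zero_rpow (by linarith : p - 1 ≠ 0)] using this.tendsto 0
  · exact (continuousAt_id.norm.rpow_const (Or.inl (norm_ne_zero_iff.2 h))).smul continuousAt_id

/-- By Cauchy–Schwarz on the cross terms, the product is at least `(‖ξ‖^(p-1) - ‖ζ‖^(p-1)) (‖ξ‖ -
‖ζ‖)`, whose factors have the same sign. -/
lemma inner_pField_sub_nonneg (hp : 1 < p) (ξ ζ : E) :
    0 ≤ inner ℝ (pField p ξ - pField p ζ) (ξ - ζ) := by
  have h1 : inner ℝ (pField p ξ) ζ ≤ ‖ξ‖ ^ (p - 1) * ‖ζ‖ := by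
    rw [← norm_pField hp]; exact real_inner_le_norm _ _
  have h2 : inner ℝ (pField p ζ) ξ ≤ ‖ζ‖ ^ (p - 1) * ‖ξ‖ := by
    rw [← norm_pField hp]; exact real_inner_le_norm _ _
  have e : ∀ ξ : E, ‖ξ‖ ^ p = ‖ξ‖ ^ (p - 1) * ‖ξ‖ := fun ξ => by
    rw [← Real.rpow_add_one' (norm_nonneg _) (by linarith)]; congr 1; ring
  have h3 : 0 ≤ (‖ξ‖ ^ (p - 1) - ‖ζ‖ ^ (p - 1)) * (‖ξ‖ - ‖ζ‖) := by
    rcases le_total ‖ξ‖ ‖ζ‖ with h | h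
    · have := Real.rpow_le_rpow (norm_nonneg _) h (by linarith : 0 ≤ p - 1)
      nlinarith
    · have := Real.rpow_le_rpow (norm_nonneg _) h (by linarith : 0 ≤ p - 1)
      nlinarith
  rw [inner_sub_left, inner_sub_right, inner_sub_right, inner_pField_self hp,
    inner_pField_self hp, e, e]
  linarith

end pField

/-- Young's inequality without sharp constants: the first term alone suffices when `b ≤ τ a`, the
second when `τ a ≤ b`. -/
lemma rpow_sub_one_mul_le {p a b τ : ℝ} (hp : 1 < p) (ha : 0 ≤ a) (hb : 0 ≤ b) (hτ : 0 < τ) :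
    a ^ (p - 1) * b ≤ τ * a ^ p + τ ^ (1 - p) * b ^ p := by
  have ea : a ^ p = a ^ (p - 1) * a := by
    rw [← Real.rpow_add_one' ha (by linarith)]; congr 1; ring
  have eb : b ^ p = b ^ (p - 1) * b := by
    rw [← Real.rpow_add_one' hb (by linarith)]; congr 1; ring
  rcases le_total b (τ * a) with h | h
  · have h1 : a ^ (p - 1) * b ≤ a ^ (p - 1) * (τ * a) := by gcongr
    have h2 : 0 ≤ τ ^ (1 - p) * b ^ p := by positivity
    rw [ea]; linarith
  · have h1 : (τ * a) ^ (p - 1) ≤ b ^ (p - 1) := by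
      apply Real.rpow_le_rpow (by positivity) h (by linarith)
    rw [Real.mul_rpow hτ.le ha] at h1
    have h2 : τ ^ (1 - p) * τ ^ (p - 1) = 1 := by
      rw [← Real.rpow_add hτ]; simp
    have h3 : a ^ (p - 1) ≤ τ ^ (1 - p) * b ^ (p - 1) := by
      calc a ^ (p - 1) = τ ^ (1 - p) * (τ ^ (p - 1) * a ^ (p - 1)) := by
            rw [← mul_assoc, h2, one_mul]
        _ ≤ _ := by gcongr
    have h4 : a ^ (p - 1) * b ≤ τ ^ (1 - p) * b ^ (p - 1) * b := by gcongr
    have h5 : 0 ≤ τ * a ^ p := by positivity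
    rw [eb]; linarith

/-! ### Calculus of gradients -/

section Gradient

variable {F : Type*} [NormedAddCommGroup F] [InnerProductSpace ℝ F] [CompleteSpace F]

lemma gradient_mul {f g : F → ℝ} {x : F} (hf : DifferentiableAt ℝ f x)
    (hg : DifferentiableAt ℝ g x) :
    ∇ (fun y => f y * g y) x = f x • ∇ g x + g x • ∇ f x := by
  simp only [gradient, fderiv_fun_mul hf hg, map_add, map_smul]

lemma gradient_sub {f g : F → ℝ} {x : F} (hf : DifferentiableAt ℝ f x)
    (hg : DifferentiableAt ℝ g x) :
    ∇ (fun y => f y - g y) x = ∇ f x - ∇ g x := by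
  simp only [gradient, fderiv_fun_sub hf hg, map_sub]

lemma gradient_neg (f : F → ℝ) (x : F) : ∇ (fun y => -f y) x = -∇ f x := by
  simp only [gradient, fderiv_fun_neg, map_neg]

lemma gradient_comp {f : F → ℝ} {g : ℝ → ℝ} {g' : ℝ} {x : F} (hg : HasDerivAt g g' (f x))
    (hf : DifferentiableAt ℝ f x) : ∇ (fun y => g (f y)) x = g' • ∇ f x := by
  have := (hg.comp_hasFDerivAt x hf.hasFDerivAt).fderiv
  simp only [gradient]
  rw [show (fun y => g (f y)) = g ∘ f from rfl, this, map_smul]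

lemma ContDiffOn.continuousOn_gradient {f : F → ℝ} {s : Set F} (hf : ContDiffOn ℝ 1 f s)
    (hs : IsOpen s) : ContinuousOn (∇ f) s :=
  (InnerProductSpace.toDual ℝ F).symm.continuous.comp_continuousOn
    (hf.continuousOn_fderiv_of_isOpen hs le_rfl)

lemma ContDiff.continuous_gradient {f : F → ℝ} (hf : ContDiff ℝ 1 f) : Continuous (∇ f) :=
  (InnerProductSpace.toDual ℝ F).symm.continuous.comp (hf.continuous_fderiv one_ne_zero)

lemma gradient_eq_zero_of_notMem_tsupport {f : F → ℝ} {x : F} (hx : x ∉ tsupport f) :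
    ∇ f x = 0 := by
  have h : fderiv ℝ f x = 0 := by
    by_contra h
    exact hx (support_fderiv_subset ℝ h)
  simp [gradient, h]

end Gradient

/-- Squaring smooths the kink of the positive part, so that truncations of `C^1` functions yield
admissible `C^1` test functions. -/
lemma hasDerivAt_max_sub_sq (k t : ℝ) :
    HasDerivAt (fun s => max (s - k) 0 ^ 2) (2 * max (t - k) 0) t := by
  rcases lt_trichotomy t k with h | h | h
  · rw [max_eq_right (by linarith), mul_zero]
    refine (hasDerivAt_const t (0 : ℝ)).congr_of_eventuallyEq ?_
    filter_upwards [Iio_mem_nhds h] with s hs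
    rw [max_eq_right (by simp at hs; linarith)]; simp
  · subst h
    simp only [sub_self, max_self, mul_zero]
    rw [hasDerivAt_iff_isLittleO]
    simp only [sub_self, max_self, smul_zero, sub_zero]
    have h1 : (fun s => max (s - t) 0 ^ 2 - 0 ^ 2) =O[𝓝 t] fun s => (s - t) ^ 2 := by
      refine Asymptotics.IsBigO.of_bound 1 (Eventually.of_forall fun s => ?_)
      have h : max (s - t) 0 ^ 2 ≤ (s - t) ^ 2 := by
        rcases le_total (s - t) 0 with h | h
        · rw [max_eq_right h]; nlinarith
        · rw [max_eq_left h]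
      simpa [abs_of_nonneg (sq_nonneg (max (s - t) 0)), abs_of_nonneg (sq_nonneg (s - t))] using h
    refine h1.trans_isLittleO ?_
    have h2 : Tendsto (fun s : ℝ => s - t) (𝓝 t) (𝓝 0) := by
      have : Continuous fun s : ℝ => s - t := by fun_prop
      simpa using this.tendsto t
    have := (Asymptotics.isLittleO_pow_id (𝕜 := ℝ) (n := 2) (by norm_num)).comp_tendsto h2
    exact this
  · rw [max_eq_left (by linarith)]
    have : HasDerivAt (fun s : ℝ => (s - k) ^ 2) (2 * (t - k)) t := by
      have := ((hasDerivAt_id t).sub_const k).fun_pow 2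
      simpa using this
    refine this.congr_of_eventuallyEq ?_
    filter_upwards [Ioi_mem_nhds h] with s hs
    rw [max_eq_left (by simp at hs; linarith)]

lemma contDiff_max_sub_sq (k : ℝ) : ContDiff ℝ 1 (fun s : ℝ => max (s - k) 0 ^ 2) := by
  rw [contDiff_one_iff_deriv]
  refine ⟨fun t => (hasDerivAt_max_sub_sq k t).differentiableAt, ?_⟩
  rw [show deriv (fun s : ℝ => max (s - k) 0 ^ 2) = fun t => 2 * max (t - k) 0 from
    funext fun t => (hasDerivAt_max_sub_sq k t).deriv]
  fun_prop

/-! ### Test functions and integrability -/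

section TestFunction

variable {N : ℕ} {Ω : Set (EuclideanSpace ℝ (Fin N))}

lemma integrableOn_of_eq_zero_off_compact {f : EuclideanSpace ℝ (Fin N) → ℝ}
    {K : Set (EuclideanSpace ℝ (Fin N))} (hf : ContinuousOn f Ω) (hK : IsCompact K)
    (hKΩ : K ⊆ Ω) (hΩ : IsOpen Ω) (h0 : ∀ x ∈ Ω, x ∉ K → f x = 0) : IntegrableOn f Ω := by
  have h1 : IntegrableOn f K := (hf.mono hKΩ).integrableOn_compact hK
  exact h1.of_forall_sdiff_eq_zero hΩ.measurableSet fun x hx => h0 x hx.1 hx.2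

lemma IsTestFunction.integrableOn {f η : EuclideanSpace ℝ (Fin N) → ℝ} {k : ℕ∞}
    (hη : IsTestFunction k Ω η) (hΩ : IsOpen Ω) (hf : ContinuousOn f Ω)
    (h0 : ∀ x ∈ Ω, x ∉ tsupport η → f x = 0) : IntegrableOn f Ω :=
  integrableOn_of_eq_zero_off_compact hf hη.2.1 hη.2.2 hΩ h0

/-- A test function times a function that is `C^1` in `Ω` is a test function. -/
lemma IsTestFunction.mul {η f : EuclideanSpace ℝ (Fin N) → ℝ} (hη : IsTestFunction 1 Ω η)
    (hΩ : IsOpen Ω) (hf : ContDiffOn ℝ 1 f Ω) : IsTestFunction 1 Ω (fun x => η x * f x) := by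
  have hsub : tsupport (fun x => η x * f x) ⊆ tsupport η :=
    closure_mono (Function.support_mul_subset_left η f)
  refine ⟨?_, hη.2.1.mul_right, hsub.trans hη.2.2⟩
  rw [contDiff_iff_contDiffAt]
  intro x
  by_cases hx : x ∈ tsupport η
  · exact hη.1.contDiffAt.mul (hf.contDiffAt (hΩ.mem_nhds (hη.2.2 hx)))
  · have : (fun x => η x * f x) =ᶠ[𝓝 x] fun _ => 0 := by
      filter_upwards [notMem_tsupport_iff_eventuallyEq.1 hx] with y hy
      simp [hy]
    exact contDiffAt_const.congr_of_eventuallyEq this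

/-- Post-composition of a test function with a `C^1` function vanishing at `0`. -/
lemma IsTestFunction.comp {η : EuclideanSpace ℝ (Fin N) → ℝ} {g : ℝ → ℝ}
    (hη : IsTestFunction 1 Ω η) (hg : ContDiff ℝ 1 g) (hg0 : g 0 = 0) :
    IsTestFunction 1 Ω (fun x => g (η x)) :=
  ⟨hg.comp hη.1, hη.2.1.comp_left hg0, (tsupport_comp_subset hg0 η).trans hη.2.2⟩

lemma IsTestFunction.rpow {η : EuclideanSpace ℝ (Fin N) → ℝ} {p : ℝ}
    (hη : IsTestFunction 1 Ω η) (hp : 1 < p) : IsTestFunction 1 Ω (fun x => η x ^ p) :=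
  hη.comp (g := fun s => s ^ p) (Real.contDiff_rpow_const_of_le (n := 1) (by simpa using hp.le))
    (Real.zero_rpow (by linarith))

lemma IsTestFunction.integrableOn_norm_gradient_rpow {η : EuclideanSpace ℝ (Fin N) → ℝ} {p : ℝ}
    (hη : IsTestFunction 1 Ω η) (hΩ : IsOpen Ω) (hp : 1 < p) :
    IntegrableOn (fun x => ‖∇ η x‖ ^ p) Ω := by
  refine hη.integrableOn hΩ ?_ fun x _ hx => ?_
  · exact (hη.1.continuous_gradient.norm.rpow_const fun _ => Or.inr (by linarith)).continuousOn
  · rw [gradient_eq_zero_of_notMem_tsupport hx, norm_zero, Real.zero_rpow (by linarith)]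

/-- Testing the `p`-Laplacian of `v` with `η ^ p * w`. -/
lemma inner_pField_gradient_rpow_mul {η w : EuclideanSpace ℝ (Fin N) → ℝ} {p : ℝ} (hp : 1 < p)
    {x ξ : EuclideanSpace ℝ (Fin N)}
    (hη : DifferentiableAt ℝ η x) (hw : DifferentiableAt ℝ w x) :
    inner ℝ ξ (∇ (fun y => η y ^ p * w y) x) =
      η x ^ p * inner ℝ ξ (∇ w x) + p * η x ^ (p - 1) * w x * inner ℝ ξ (∇ η x) := by
  have hd := Real.hasDerivAt_rpow_const (x := η x) (p := p) (Or.inr hp.le)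
  rw [gradient_mul (f := fun y => η y ^ p) (hd.differentiableAt.comp x hη) hw, gradient_comp hd hη, inner_add_right,
    real_inner_smul_right, smul_smul, real_inner_smul_right]
  ring

end TestFunction

/-! ### Local energy estimate on superlevel sets -/

section Caccioppoli

variable {N : ℕ} {Ω : Set (EuclideanSpace ℝ (Fin N))}

/-- **Caccioppoli inequality** on the superlevel sets of a function `v` which satisfies
`-Δ_p v ≤ C` weakly in `{v > k}`. -/
theorem caccioppoli (hΩ : IsOpen Ω) (hfin : volume Ω ≠ ⊤) {p k C M s : ℝ} (hp : 1 < p)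
    (hC : 0 ≤ C) (hs : 0 < s) {v : EuclideanSpace ℝ (Fin N) → ℝ} (hv : ContDiffOn ℝ 1 v Ω)
    (hM : ∀ x ∈ Ω, v x ≤ M)
    (hsub : ∀ φ, IsTestFunction 1 Ω φ → (∀ x, 0 ≤ φ x) → (∀ x ∈ Ω, v x ≤ k → φ x = 0) →
      ∫ x in Ω, inner ℝ (pField p (∇ v x)) (∇ φ x) ≤ C * ∫ x in Ω, φ x) :
    ∃ D : ℝ, 0 ≤ D ∧ ∀ η, IsTestFunction 1 Ω η → (∀ x, 0 ≤ η x) → (∀ x, η x ≤ 1) →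
      ∫ x in Ω ∩ {x | k + s ≤ v x}, η x ^ p * ‖∇ v x‖ ^ p ≤
        D * (1 + ∫ x in Ω, ‖∇ η x‖ ^ p) := by
  set L : ℝ := |M - k| + 1 with hL
  have hL0 : 0 < L := by positivity
  -- Chosen so that `p * L * τ = 1`: Young's inequality then costs exactly one of the two copies of
  -- `∫ η^p P |∇v|^p` produced by the test function.
  set τ : ℝ := 1 / (p * L) with hτ
  have hτ0 : 0 < τ := by positivity
  have hpτ : p * L * τ = 1 := by rw [hτ]; field_simp
  set D₀ : ℝ := C * L ^ 2 * volume.real Ω + p * L * L * τ ^ (1 - p) with hD₀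
  have hD₀0 : 0 ≤ D₀ := by positivity
  refine ⟨D₀ / s, by positivity, fun η hη hη0 hη1 => ?_⟩
  set P : EuclideanSpace ℝ (Fin N) → ℝ := fun x => max (v x - k) 0 with hP
  have hP0 : ∀ x, 0 ≤ P x := fun x => le_max_right _ _
  have hPL : ∀ x ∈ Ω, P x ≤ L := fun x hx =>
    max_le (by linarith [hM x hx, le_abs_self (M - k)]) hL0.le
  have hvc := hv.continuousOn
  have hPc : ContinuousOn P Ω := by
    have : Continuous fun t : ℝ => max (t - k) 0 := by fun_prop
    exact this.comp_continuousOn hvc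
  have hgv := hv.continuousOn_gradient hΩ
  have hgη := hη.1.continuous_gradient
  have hηc := hη.1.continuous
  have hηp : Continuous fun x => η x ^ p := hηc.rpow_const fun _ => Or.inr (by linarith)
  have hηp1 : Continuous fun x => η x ^ (p - 1) :=
    hηc.rpow_const fun _ => Or.inr (by linarith)
  have hgvp : ContinuousOn (fun x => ‖∇ v x‖ ^ p) Ω :=
    hgv.norm.rpow_const fun _ _ => Or.inr (by linarith)
  have hAc : ContinuousOn (fun x => pField p (∇ v x)) Ω :=
    (continuous_pField hp).comp_continuousOn hgv
  have hη0t : ∀ x, x ∉ tsupport η → η x = 0 := fun x hx => image_eq_zero_of_notMem_tsupport hx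
  have hp0 : p ≠ 0 := by linarith
  have hp10 : p - 1 ≠ 0 := by linarith
  have hdP : ContDiffOn ℝ 1 (fun x => P x ^ 2) Ω :=
    (contDiff_max_sub_sq k).comp_contDiffOn hv
  have hφ : IsTestFunction 1 Ω (fun x => η x ^ p * P x ^ 2) := (hη.rpow hp).mul hΩ hdP
  have key := hsub _ hφ (fun x => by have := hη0 x; positivity) (fun x _ hx => by
    have : P x = 0 := max_eq_right (by linarith)
    simp [this])
  have hgrad : ∀ x ∈ Ω, inner ℝ (pField p (∇ v x)) (∇ (fun x => η x ^ p * P x ^ 2) x) =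
      2 * (η x ^ p * P x * ‖∇ v x‖ ^ p) +
        p * η x ^ (p - 1) * P x ^ 2 * inner ℝ (pField p (∇ v x)) (∇ η x) := fun x hx => by
    have hvd : DifferentiableAt ℝ v x :=
      (hv.differentiableOn one_ne_zero).differentiableAt (hΩ.mem_nhds hx)
    have hPd : DifferentiableAt ℝ (fun x => P x ^ 2) x :=
      (hdP.differentiableOn one_ne_zero).differentiableAt (hΩ.mem_nhds hx)
    rw [inner_pField_gradient_rpow_mul hp (hη.1.differentiable one_ne_zero x) hPd,
      gradient_comp (f := v) (hasDerivAt_max_sub_sq k (v x)) hvd, real_inner_smul_right,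
      inner_pField_self hp]
    ring
  rw [setIntegral_congr_fun hΩ.measurableSet hgrad] at key
  have i1 : IntegrableOn (fun x => η x ^ p * P x * ‖∇ v x‖ ^ p) Ω := by
    refine hη.integrableOn hΩ ((hηp.continuousOn.mul hPc).mul hgvp) fun x _ hx => ?_
    rw [hη0t x hx, Real.zero_rpow hp0]; simp
  have i2 : IntegrableOn (fun x => p * η x ^ (p - 1) * P x ^ 2 *
      inner ℝ (pField p (∇ v x)) (∇ η x)) Ω := by
    refine hη.integrableOn hΩ (((continuousOn_const.mul hηp1.continuousOn).mul (hPc.pow 2)).mul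
      (hAc.inner hgη.continuousOn)) fun x _ hx => ?_
    rw [hη0t x hx, Real.zero_rpow hp10]; simp
  have i3 : IntegrableOn (fun x => ‖∇ η x‖ ^ p) Ω := hη.integrableOn_norm_gradient_rpow hΩ hp
  have i4 : IntegrableOn (fun x => η x ^ p * ‖∇ v x‖ ^ p) Ω := by
    refine hη.integrableOn hΩ (hηp.continuousOn.mul hgvp) fun x _ hx => ?_
    rw [hη0t x hx, Real.zero_rpow hp0]; simp
  have i5 : IntegrableOn (fun x => η x ^ p * P x ^ 2) Ω :=
    hφ.1.continuous.integrable_of_hasCompactSupport hφ.2.1 |>.integrableOn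
  rw [integral_add (i1.const_mul 2) i2, integral_const_mul] at key
  have b1 : ∫ x in Ω, η x ^ p * P x ^ 2 ≤ L ^ 2 * volume.real Ω := by
    have : ∫ x in Ω, η x ^ p * P x ^ 2 ≤ ∫ x in Ω, L ^ 2 := by
      refine setIntegral_mono_on i5 (integrableOn_const hfin) hΩ.measurableSet fun x hx => ?_
      have h1 : η x ^ p ≤ 1 := Real.rpow_le_one (hη0 x) (hη1 x) (by linarith)
      have h2 : P x ^ 2 ≤ L ^ 2 := pow_le_pow_left₀ (hP0 x) (hPL x hx) 2
      calc η x ^ p * P x ^ 2 ≤ 1 * L ^ 2 := by gcongr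
        _ = L ^ 2 := one_mul _
    rwa [setIntegral_const, smul_eq_mul, mul_comm] at this
  -- Only one factor of `P ^ 2` is bounded by `L` in the gradient term; the other is kept, so that
  -- the term can be absorbed.
  have b2 : -∫ x in Ω, p * η x ^ (p - 1) * P x ^ 2 * inner ℝ (pField p (∇ v x)) (∇ η x) ≤
      (∫ x in Ω, η x ^ p * P x * ‖∇ v x‖ ^ p) +
        p * L * L * τ ^ (1 - p) * ∫ x in Ω, ‖∇ η x‖ ^ p := by
    rw [← integral_neg, ← integral_const_mul, ← integral_add i1 (i3.const_mul _)]
    refine setIntegral_mono_on i2.neg (i1.add (i3.const_mul _)) hΩ.measurableSet fun x hx => ?_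
    have h1 : -inner ℝ (pField p (∇ v x)) (∇ η x) ≤ ‖∇ v x‖ ^ (p - 1) * ‖∇ η x‖ := by
      rw [← norm_pField hp]
      exact (neg_le_abs _).trans (abs_real_inner_le_norm _ _)
    have h2 := rpow_sub_one_mul_le hp (mul_nonneg (hη0 x) (norm_nonneg (∇ v x)))
      (norm_nonneg (∇ η x)) hτ0
    rw [Real.mul_rpow (hη0 x) (norm_nonneg _), Real.mul_rpow (hη0 x) (norm_nonneg _)] at h2
    have hPx := hP0 x
    have hPLx := hPL x hx
    have hηx := hη0 x
    calc -(p * η x ^ (p - 1) * P x ^ 2 * inner ℝ (pField p (∇ v x)) (∇ η x))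
        = p * η x ^ (p - 1) * P x ^ 2 * (-inner ℝ (pField p (∇ v x)) (∇ η x)) := by ring
      _ ≤ p * η x ^ (p - 1) * P x ^ 2 * (‖∇ v x‖ ^ (p - 1) * ‖∇ η x‖) := by gcongr
      _ = p * P x * P x * (η x ^ (p - 1) * ‖∇ v x‖ ^ (p - 1) * ‖∇ η x‖) := by ring
      _ ≤ p * P x * L * (τ * (η x ^ p * ‖∇ v x‖ ^ p) + τ ^ (1 - p) * ‖∇ η x‖ ^ p) := by gcongr
      _ = p * L * τ * (η x ^ p * P x * ‖∇ v x‖ ^ p) +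
            p * P x * L * (τ ^ (1 - p) * ‖∇ η x‖ ^ p) := by ring
      _ ≤ 1 * (η x ^ p * P x * ‖∇ v x‖ ^ p) + p * L * L * (τ ^ (1 - p) * ‖∇ η x‖ ^ p) := by
          rw [hpτ]; gcongr
      _ = _ := by ring
  have hmeas : MeasurableSet (Ω ∩ {x | k + s ≤ v x}) := by
    have : Ω ∩ {x | k + s ≤ v x} = Ω \ (Ω ∩ v ⁻¹' Set.Iio (k + s)) := by
      ext x; simp
    rw [this]
    exact hΩ.measurableSet.diff (hvc.isOpen_inter_preimage hΩ isOpen_Iio).measurableSet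
  have b3 : s * ∫ x in Ω ∩ {x | k + s ≤ v x}, η x ^ p * ‖∇ v x‖ ^ p ≤
      ∫ x in Ω, η x ^ p * P x * ‖∇ v x‖ ^ p := by
    rw [← integral_const_mul]
    have hsubset : Ω ∩ {x | k + s ≤ v x} ⊆ Ω := Set.inter_subset_left
    calc ∫ x in Ω ∩ {x | k + s ≤ v x}, s * (η x ^ p * ‖∇ v x‖ ^ p)
        ≤ ∫ x in Ω ∩ {x | k + s ≤ v x}, η x ^ p * P x * ‖∇ v x‖ ^ p := by
          refine setIntegral_mono_on ((i4.mono_set hsubset).const_mul s) (i1.mono_set hsubset)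
            hmeas fun x hx => ?_
          have h1 : s ≤ P x := le_max_of_le_left (by have := hx.2; simp at this; linarith)
          have hηx := hη0 x
          calc s * (η x ^ p * ‖∇ v x‖ ^ p) ≤ P x * (η x ^ p * ‖∇ v x‖ ^ p) := by gcongr
            _ = _ := by ring
      _ ≤ _ := by
          refine setIntegral_mono_set i1 ?_ hsubset.eventuallyLE
          refine Eventually.of_forall fun x => ?_
          have hηx := hη0 x
          have hPx := hP0 x
          simp only [Pi.zero_apply]; positivity
  have hI : 0 ≤ ∫ x in Ω, ‖∇ η x‖ ^ p := integral_nonneg fun x => by positivity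
  have b4 : C * ∫ x in Ω, η x ^ p * P x ^ 2 ≤ C * (L ^ 2 * volume.real Ω) := by gcongr
  have hC1 : 0 ≤ C * (L ^ 2 * volume.real Ω) := by positivity
  have hC2 : 0 ≤ p * L * L * τ ^ (1 - p) := by positivity
  have b5 : s * ∫ x in Ω ∩ {x | k + s ≤ v x}, η x ^ p * ‖∇ v x‖ ^ p ≤
      D₀ * (1 + ∫ x in Ω, ‖∇ η x‖ ^ p) := by
    rw [hD₀]
    nlinarith [mul_nonneg hC1 hI]
  rw [div_mul_eq_mul_div, le_div_iff₀ hs]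
  linarith

end Caccioppoli

lemma integral_norm_rpow_eq_eLpNorm {α F : Type*} [MeasurableSpace α] {μ : Measure α}
    [NormedAddCommGroup F] {f : α → F} {p : ℝ} (hp : 0 < p)
    (hf : MemLp f (ENNReal.ofReal p) μ) :
    ∫ x, ‖f x‖ ^ p ∂μ = (eLpNorm f (ENNReal.ofReal p) μ).toReal ^ p := by
  have h0 : 0 ≤ ∫ x, ‖f x‖ ^ p ∂μ := integral_nonneg fun x => by positivity
  rw [hf.eLpNorm_eq_integral_rpow_norm (by simpa using hp) ENNReal.ofReal_ne_top,
    ENNReal.toReal_ofReal hp.le, ENNReal.toReal_ofReal (by positivity),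
    Real.rpow_inv_rpow h0 hp.ne']

/-- A `C^1` step function from `0` to `1` on `[0, δ]`. -/
lemma exists_smooth_step {δ : ℝ} (hδ : 0 < δ) :
    ∃ (S : ℝ → ℝ) (R : ℝ), ContDiff ℝ 1 S ∧ 0 ≤ R ∧ S 0 = 0 ∧ (∀ t, 0 ≤ S t) ∧ (∀ t, S t ≤ 1) ∧
      (∀ t, δ ≤ t → S t = 1) ∧ (∀ t, |deriv S t| ≤ R) ∧ ∀ t, δ < t → deriv S t = 0 := by
  set S : ℝ → ℝ := fun t => Real.smoothTransition (t / δ) with hS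
  have hSd : ContDiff ℝ 1 S := Real.smoothTransition.contDiff.comp (contDiff_id.div_const δ)
  have h1 : ∀ t, δ ≤ t → S t = 1 := fun t ht =>
    Real.smoothTransition.one_of_one_le ((one_le_div hδ).2 ht)
  have hd1 : ∀ t, δ < t → deriv S t = 0 := fun t ht => by
    have : S =ᶠ[𝓝 t] fun _ => 1 := by
      filter_upwards [Ioi_mem_nhds ht] with s hs using h1 s (le_of_lt hs)
    rw [this.deriv_eq, deriv_const]
  have hd0 : ∀ t, t < 0 → deriv S t = 0 := fun t ht => by
    have : S =ᶠ[𝓝 t] fun _ => 0 := by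
      filter_upwards [Iio_mem_nhds ht] with s hs
      exact Real.smoothTransition.zero_of_nonpos
        (div_nonpos_of_nonpos_of_nonneg (le_of_lt hs) hδ.le)
    rw [this.deriv_eq, deriv_const]
  obtain ⟨R, hR⟩ := (isCompact_Icc (a := 0) (b := δ)).exists_bound_of_continuousOn
    (hSd.continuous_deriv le_rfl).continuousOn
  have hR0 : 0 ≤ R := (norm_nonneg _).trans (hR 0 ⟨le_rfl, hδ.le⟩)
  refine ⟨S, R, hSd, hR0, by simp [hS], fun t => Real.smoothTransition.nonneg _,
    fun t => Real.smoothTransition.le_one _, h1, fun t => ?_, hd1⟩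
  rcases lt_or_ge t 0 with h | h
  · simpa [hd0 t h] using hR0
  rcases lt_or_ge δ t with h' | h'
  · simpa [hd1 t h'] using hR0
  · exact hR t ⟨h, h'⟩

/-! ### Cutoff functions from membership in `W^{1,p}_0` -/

section Cutoff

variable {N : ℕ} {Ω : Set (EuclideanSpace ℝ (Fin N))}

/-- A function in `W^{1,p}_0(Ω)` provides cutoff functions in `Ω` which converge to `1` on its
superlevel sets, with `p`-energy tending to zero there. -/
theorem MemW1pZero.exists_cutoff (hΩ : IsOpen Ω) {p δ : ℝ} (hp : 1 < p) (hδ : 0 < δ)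
    {w : EuclideanSpace ℝ (Fin N) → ℝ} (hwc : ContinuousOn w Ω) (hw : MemW1pZero p Ω w) :
    ∃ (η : ℕ → EuclideanSpace ℝ (Fin N) → ℝ) (B : ℝ), (∀ n, IsTestFunction 1 Ω (η n)) ∧
      (∀ n x, 0 ≤ η n x) ∧ (∀ n x, η n x ≤ 1) ∧ (∀ᶠ n in atTop, ∫ x in Ω, ‖∇ (η n) x‖ ^ p ≤ B) ∧
      Tendsto (fun n => ∫ x in Ω ∩ {x | 2 * δ < w x}, ‖∇ (η n) x‖ ^ p) atTop (𝓝 0) ∧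
      Tendsto (fun n => volume (Ω ∩ {x | 2 * δ < w x} ∩ {x | η n x < 1})) atTop (𝓝 0) := by
  obtain ⟨G, -, hwL, hGL, φ, hφ, hφw, hφG⟩ := hw
  obtain ⟨S, R, hSd, hR0, hS0, hSn, hS1, hSone, hSR, hSder⟩ := exists_smooth_step hδ
  set q := ENNReal.ofReal p with hq
  have hq1 : 1 ≤ q := by rw [hq]; simpa using hp.le
  have hqt : q ≠ ⊤ := ENNReal.ofReal_ne_top
  have hq0 : q ≠ 0 := (zero_lt_one.trans_le hq1).ne'
  set μ := volume.restrict Ω with hμ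
  set E := Ω ∩ {x | 2 * δ < w x} with hE
  have hEm : MeasurableSet E := (hwc.isOpen_inter_preimage hΩ isOpen_Ioi).measurableSet
  have hφ1 : ∀ n, IsTestFunction 1 Ω (φ n) := fun n =>
    ⟨(hφ n).1.of_le (by exact_mod_cast le_top), (hφ n).2⟩
  have hη : ∀ n, IsTestFunction 1 Ω (fun x => S (φ n x)) := fun n => (hφ1 n).comp hSd hS0
  have hgrad : ∀ n x, ∇ (fun x => S (φ n x)) x = deriv S (φ n x) • ∇ (φ n) x := fun n x =>
    gradient_comp (hSd.differentiable one_ne_zero _).hasDerivAt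
      ((hφ1 n).1.differentiable one_ne_zero x)
  -- The part of `E` where the step function need not be constant. There `w > 2δ` and `φ n ≤ δ`, so
  -- `|φ n - w| > δ`, and convergence in measure makes `A n` small.
  set A : ℕ → Set (EuclideanSpace ℝ (Fin N)) := fun n => E ∩ {x | φ n x ≤ δ} with hA
  have hAm : ∀ n, MeasurableSet (A n) := fun n =>
    hEm.inter (isClosed_le (hφ1 n).1.continuous continuous_const).measurableSet
  have hφm : ∀ n, AEStronglyMeasurable (φ n) μ := fun n =>
    (hφ1 n).1.continuous.aestronglyMeasurable
  have hgm : ∀ n, AEStronglyMeasurable (∇ (φ n)) μ := fun n =>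
    (hφ1 n).1.continuous_gradient.aestronglyMeasurable
  have hμA : Tendsto (fun n => μ (A n)) atTop (𝓝 0) := by
    have h1 : Tendsto (fun n => eLpNorm (φ n - w) q μ) atTop (𝓝 0) := by
      refine hφw.congr fun n => ?_
      rw [eLpNorm_sub_comm]; rfl
    have h2 := (tendstoInMeasure_of_tendsto_eLpNorm hq0 hφm hwL.1 h1) (ENNReal.ofReal δ)
      (by simpa using hδ)
    refine tendsto_of_tendsto_of_tendsto_of_le_of_le tendsto_const_nhds h2
      (fun _ => zero_le) fun n => measure_mono ?_
    rintro x ⟨⟨-, hx1⟩, hx2⟩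
    simp only [Set.mem_ofPred_eq] at hx1 hx2 ⊢
    rw [edist_dist]
    apply ENNReal.ofReal_le_ofReal
    rw [dist_comm, Real.dist_eq]
    exact le_trans (by linarith) (le_abs_self _)
  -- Absolute continuity of the integral of `|G|^p` along the shrinking sets `A n`.
  have hindG : Tendsto (fun n => eLpNorm ((A n).indicator G) q μ) atTop (𝓝 0) := by
    rw [ENNReal.tendsto_nhds_zero]
    intro ε hε
    obtain ⟨r, hr0, hrε⟩ : ∃ r : ℝ, 0 < r ∧ ENNReal.ofReal r ≤ ε := by
      rcases eq_or_ne ε ⊤ with rfl | h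
      · exact ⟨1, one_pos, le_top⟩
      · exact ⟨ε.toReal, ENNReal.toReal_pos hε.ne' h, ENNReal.ofReal_toReal_le⟩
    obtain ⟨d, hd0, hd⟩ := hGL.eLpNorm_indicator_le hq1 hqt hr0
    filter_upwards [(ENNReal.tendsto_nhds_zero.1 hμA) (ENNReal.ofReal d) (by simpa using hd0)]
      with n hn
    exact (hd _ (hAm n) hn).trans hrε
  have hindφ : Tendsto (fun n => ENNReal.ofReal R * eLpNorm ((A n).indicator (∇ (φ n))) q μ)
      atTop (𝓝 0) := by
    have h1 := hindG.add hφG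
    rw [zero_add] at h1
    have h2 : Tendsto (fun n => eLpNorm ((A n).indicator (∇ (φ n))) q μ) atTop (𝓝 0) := by
      refine tendsto_of_tendsto_of_tendsto_of_le_of_le tendsto_const_nhds h1
        (fun _ => zero_le) fun n => ?_
      have e : (A n).indicator (∇ (φ n)) =
          (A n).indicator G - (A n).indicator (fun x => G x - ∇ (φ n) x) := by
        ext1 x
        by_cases hx : x ∈ A n <;> simp [hx]
      rw [e]
      refine (eLpNorm_sub_le (hGL.1.indicator (hAm n))
        ((hGL.1.sub (hgm n)).indicator (hAm n)) hq1).trans ?_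
      gcongr
      exact eLpNorm_indicator_le _
    have := ENNReal.Tendsto.const_mul (a := ENNReal.ofReal R) h2 (Or.inr ENNReal.ofReal_ne_top)
    simpa using this
  have hηg : ∀ n, MemLp (∇ (fun x => S (φ n x))) q μ := fun n => by
    have : HasCompactSupport (∇ (fun x => S (φ n x))) :=
      HasCompactSupport.of_support_subset_isCompact (hη n).2.1 fun x hx => by
        by_contra h
        exact hx (gradient_eq_zero_of_notMem_tsupport h)
    exact ((hη n).1.continuous_gradient.memLp_of_hasCompactSupport this).restrict _
  have hp0 : 0 < p := by linarith
  -- The bound comes from `|S'| ≤ R` and `‖∇ (φ n)‖ ≤ ‖G‖ + 1` in `L^p`, valid once `‖G - ∇ (φ n)‖ ≤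
  -- 1`.
  refine ⟨fun n x => S (φ n x), (ENNReal.ofReal R * (eLpNorm G q μ + 1)).toReal ^ p, hη,
    fun n x => hSn _, fun n x => hS1 _, ?_, ?_, ?_⟩
  · filter_upwards [(ENNReal.tendsto_nhds_zero.1 hφG) 1 one_pos] with n hn
    rw [integral_norm_rpow_eq_eLpNorm hp0 (hηg n)]
    refine Real.rpow_le_rpow ENNReal.toReal_nonneg (ENNReal.toReal_mono ?_ ?_) hp0.le
    · exact ENNReal.mul_ne_top ENNReal.ofReal_ne_top
        (ENNReal.add_ne_top.2 ⟨hGL.eLpNorm_ne_top, ENNReal.one_ne_top⟩)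
    · have h1 : eLpNorm (∇ (fun x => S (φ n x))) q μ ≤ ENNReal.ofReal R * eLpNorm (∇ (φ n)) q μ :=
        eLpNorm_le_mul_eLpNorm_of_ae_le_mul (Eventually.of_forall fun x => by
          rw [hgrad, norm_smul]
          have := hSR (φ n x)
          rw [Real.norm_eq_abs]; gcongr) q
      refine h1.trans ?_
      gcongr
      have e : ∇ (φ n) = G - fun x => G x - ∇ (φ n) x := by
        ext1 x; simp
      rw [e]
      refine (eLpNorm_sub_le hGL.1 (hGL.1.sub (hgm n)) hq1).trans ?_
      exact add_le_add_right hn _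
  · have h1 : ∀ n, eLpNorm (∇ (fun x => S (φ n x))) q (volume.restrict E) ≤
        ENNReal.ofReal R * eLpNorm ((A n).indicator (∇ (φ n))) q μ := fun n => by
      have e : volume.restrict E = μ.restrict E := by
        rw [hμ, Measure.restrict_restrict hEm, Set.inter_eq_left.2 Set.inter_subset_left]
      rw [e, ← eLpNorm_indicator_eq_eLpNorm_restrict hEm]
      refine eLpNorm_le_mul_eLpNorm_of_ae_le_mul (Eventually.of_forall fun x => ?_) q
      by_cases hx : x ∈ E
      · rw [Set.indicator_of_mem hx, hgrad, norm_smul, Real.norm_eq_abs]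
        by_cases hx' : φ n x ≤ δ
        · rw [Set.indicator_of_mem (show x ∈ A n from ⟨hx, hx'⟩)]
          have := hSR (φ n x)
          gcongr
        · rw [hSder _ (not_le.1 hx'), abs_zero, zero_mul]
          positivity
      · rw [Set.indicator_of_notMem hx, norm_zero]
        positivity
    have h2 := tendsto_of_tendsto_of_tendsto_of_le_of_le tendsto_const_nhds hindφ
      (fun _ => zero_le) h1
    have h3 := (ENNReal.tendsto_toReal ENNReal.zero_ne_top).comp h2
    have h4 := h3.rpow_const (p := p) (Or.inr hp0.le)
    simp only [ENNReal.toReal_zero, Real.zero_rpow hp0.ne'] at h4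
    refine h4.congr fun n => ?_
    rw [integral_norm_rpow_eq_eLpNorm hp0
      ((hηg n).mono_measure (Measure.restrict_mono Set.inter_subset_left le_rfl))]
    rfl
  · refine tendsto_of_tendsto_of_tendsto_of_le_of_le tendsto_const_nhds hμA
      (fun _ => zero_le) fun n => ?_
    rw [hμ, Measure.restrict_apply (hAm n)]
    refine measure_mono fun x hx => ⟨⟨hx.1, ?_⟩, hx.1.1⟩
    by_contra h
    exact (ne_of_lt hx.2) (hSone _ (le_of_lt (not_le.1 h)))

end Cutoff

/-! ### Comparison by testing with truncated differences -/

section Core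

variable {N : ℕ} {Ω : Set (EuclideanSpace ℝ (Fin N))}

/-- Testing the two inequalities with `η ^ p * max (v₁ - v₂ - κ) 0 ^ 2`. -/
lemma integral_sub_mul_le_of_sub_super (hΩ : IsOpen Ω) {p κ τ L : ℝ} (hp : 1 < p) (hτ : 0 < τ)
    {v₁ v₂ f₁ f₂ η : EuclideanSpace ℝ (Fin N) → ℝ}
    (hv₁ : ContDiffOn ℝ 1 v₁ Ω) (hv₂ : ContDiffOn ℝ 1 v₂ Ω)
    (hf₁ : ContinuousOn f₁ Ω) (hf₂ : ContinuousOn f₂ Ω)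
    (hsub : ∀ φ, IsTestFunction 1 Ω φ → (∀ x, 0 ≤ φ x) →
      ∫ x in Ω, inner ℝ (pField p (∇ v₁ x)) (∇ φ x) ≤ ∫ x in Ω, f₁ x * φ x)
    (hsup : ∀ φ, IsTestFunction 1 Ω φ → (∀ x, 0 ≤ φ x) →
      ∫ x in Ω, f₂ x * φ x ≤ ∫ x in Ω, inner ℝ (pField p (∇ v₂ x)) (∇ φ x))
    {E : Set (EuclideanSpace ℝ (Fin N))} (hEm : MeasurableSet E) (hEΩ : E ⊆ Ω)
    (hκE : ∀ x ∈ Ω, κ < v₁ x - v₂ x → x ∈ E) (hL : ∀ x ∈ E, max (v₁ x - v₂ x - κ) 0 ^ 2 ≤ L)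
    (hη : IsTestFunction 1 Ω η) (hη0 : ∀ x, 0 ≤ η x) :
    ∫ x in E, (f₂ x - f₁ x) * (η x ^ p * max (v₁ x - v₂ x - κ) 0 ^ 2) ≤
      p * L * (τ * ((∫ x in E, η x ^ p * ‖∇ v₁ x‖ ^ p) + ∫ x in E, η x ^ p * ‖∇ v₂ x‖ ^ p) +
        2 * τ ^ (1 - p) * ∫ x in E, ‖∇ η x‖ ^ p) := by
  have hp0 : p ≠ 0 := by linarith
  have hp10 : p - 1 ≠ 0 := by linarith
  have hv : ContDiffOn ℝ 1 (fun x => v₁ x - v₂ x) Ω := hv₁.sub hv₂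
  set Q : EuclideanSpace ℝ (Fin N) → ℝ := fun x => max (v₁ x - v₂ x - κ) 0 ^ 2 with hQ
  have hQ0 : ∀ x, 0 ≤ Q x := fun x => sq_nonneg _
  have hQd : ContDiffOn ℝ 1 Q Ω := (contDiff_max_sub_sq κ).comp_contDiffOn hv
  have hQE : ∀ x ∈ Ω, x ∉ E → Q x = 0 := fun x hx hxE => by
    have : v₁ x - v₂ x - κ ≤ 0 := by
      by_contra h
      exact hxE (hκE x hx (by linarith))
    simp [hQ, max_eq_right this]
  have hφ : IsTestFunction 1 Ω (fun x => η x ^ p * Q x) := (hη.rpow hp).mul hΩ hQd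
  have hφ0 : ∀ x, 0 ≤ η x ^ p * Q x := fun x => by
    have := hη0 x; have := hQ0 x; positivity
  have hη0t : ∀ x, x ∉ tsupport η → η x = 0 := fun x hx => image_eq_zero_of_notMem_tsupport hx
  have hg₁ := hv₁.continuousOn_gradient hΩ
  have hg₂ := hv₂.continuousOn_gradient hΩ
  have hA₁ : ContinuousOn (fun x => pField p (∇ v₁ x)) Ω :=
    (continuous_pField hp).comp_continuousOn hg₁
  have hA₂ : ContinuousOn (fun x => pField p (∇ v₂ x)) Ω :=
    (continuous_pField hp).comp_continuousOn hg₂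
  have hgη := hη.1.continuous_gradient
  have hηc := hη.1.continuous
  have hηp : Continuous fun x => η x ^ p := hηc.rpow_const fun _ => Or.inr (by linarith)
  have hηp1 : Continuous fun x => η x ^ (p - 1) :=
    hηc.rpow_const fun _ => Or.inr (by linarith)
  have hgφ := hφ.1.continuous_gradient
  have iφ : ∀ {V : EuclideanSpace ℝ (Fin N) → EuclideanSpace ℝ (Fin N)}, ContinuousOn V Ω →
      IntegrableOn (fun x => inner ℝ (V x) (∇ (fun x => η x ^ p * Q x) x)) Ω := fun hV => by
    refine hφ.integrableOn hΩ (hV.inner hgφ.continuousOn) fun x _ hx => ?_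
    rw [gradient_eq_zero_of_notMem_tsupport hx, inner_zero_right]
  have if' : ∀ {f : EuclideanSpace ℝ (Fin N) → ℝ}, ContinuousOn f Ω →
      IntegrableOn (fun x => f x * (η x ^ p * Q x)) Ω := fun hf => by
    refine hφ.integrableOn hΩ (hf.mul hφ.1.continuous.continuousOn) fun x _ hx => ?_
    rw [image_eq_zero_of_notMem_tsupport (f := fun x => η x ^ p * Q x) hx, mul_zero]
  have ig : ∀ {v : EuclideanSpace ℝ (Fin N) → ℝ}, ContinuousOn (∇ v) Ω →
      IntegrableOn (fun x => η x ^ p * ‖∇ v x‖ ^ p) Ω := fun hv => by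
    refine hη.integrableOn hΩ (hηp.continuousOn.mul (hv.norm.rpow_const
      fun _ _ => Or.inr (by linarith))) fun x _ hx => ?_
    rw [hη0t x hx, Real.zero_rpow hp0, zero_mul]
  have iη : IntegrableOn (fun x => ‖∇ η x‖ ^ p) Ω := hη.integrableOn_norm_gradient_rpow hΩ hp
  have key : ∫ x in Ω, (f₂ x - f₁ x) * (η x ^ p * Q x) ≤
      ∫ x in Ω, inner ℝ (pField p (∇ v₂ x) - pField p (∇ v₁ x))
        (∇ (fun x => η x ^ p * Q x) x) := by
    have h1 := hsub _ hφ hφ0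
    have h2 := hsup _ hφ hφ0
    simp only [sub_mul, inner_sub_left]
    rw [integral_sub (if' hf₂) (if' hf₁), integral_sub (iφ hA₂) (iφ hA₁)]
    linarith
  have hgrad : ∀ x ∈ Ω, inner ℝ (pField p (∇ v₂ x) - pField p (∇ v₁ x))
        (∇ (fun x => η x ^ p * Q x) x) ≤
      p * η x ^ (p - 1) * Q x * inner ℝ (pField p (∇ v₂ x) - pField p (∇ v₁ x)) (∇ η x) := by
    intro x hx
    have hd₁ : DifferentiableAt ℝ v₁ x :=
      (hv₁.differentiableOn one_ne_zero).differentiableAt (hΩ.mem_nhds hx)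
    have hd₂ : DifferentiableAt ℝ v₂ x :=
      (hv₂.differentiableOn one_ne_zero).differentiableAt (hΩ.mem_nhds hx)
    have hQd' : DifferentiableAt ℝ Q x :=
      (hQd.differentiableOn one_ne_zero).differentiableAt (hΩ.mem_nhds hx)
    rw [inner_pField_gradient_rpow_mul hp (hη.1.differentiable one_ne_zero x) hQd',
      gradient_comp (f := fun x => v₁ x - v₂ x) (hasDerivAt_max_sub_sq κ _) (hd₁.sub hd₂),
      gradient_sub hd₁ hd₂, real_inner_smul_right]
    have h1 := inner_pField_sub_nonneg hp (∇ v₁ x) (∇ v₂ x)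
    -- The term with `∇Q` has a favourable sign by monotonicity and is dropped; only the cutoff
    -- error remains.
    have h2 : inner ℝ (pField p (∇ v₂ x) - pField p (∇ v₁ x)) (∇ v₁ x - ∇ v₂ x) ≤ 0 := by
      rw [← neg_sub (pField p (∇ v₁ x)), inner_neg_left]; linarith
    have h3 : 0 ≤ η x ^ p * (2 * max (v₁ x - v₂ x - κ) 0) := by
      have := hη0 x; positivity
    have h4 := mul_nonpos_of_nonneg_of_nonpos h3 h2
    linarith [mul_assoc (η x ^ p) (2 * max (v₁ x - v₂ x - κ) 0)
      (inner ℝ (pField p (∇ v₂ x) - pField p (∇ v₁ x)) (∇ v₁ x - ∇ v₂ x))]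
  have iA : IntegrableOn (fun x => p * η x ^ (p - 1) * Q x *
      inner ℝ (pField p (∇ v₂ x) - pField p (∇ v₁ x)) (∇ η x)) Ω := by
    refine hη.integrableOn hΩ (((continuousOn_const.mul hηp1.continuousOn).mul
      hQd.continuousOn).mul ((hA₂.sub hA₁).inner hgη.continuousOn)) fun x _ hx => ?_
    rw [hη0t x hx, Real.zero_rpow hp10]; simp
  have hbound : ∀ x ∈ E, p * η x ^ (p - 1) * Q x *
      inner ℝ (pField p (∇ v₂ x) - pField p (∇ v₁ x)) (∇ η x) ≤
      p * L * (τ * (η x ^ p * ‖∇ v₁ x‖ ^ p + η x ^ p * ‖∇ v₂ x‖ ^ p) +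
        2 * τ ^ (1 - p) * ‖∇ η x‖ ^ p) := by
    intro x hx
    have hηx := hη0 x
    have hQx := hQ0 x
    have hQL : Q x ≤ L := hL x hx
    have hL0 : 0 ≤ L := hQx.trans hQL
    have hpL : 0 ≤ p * L := by positivity
    have h1 : inner ℝ (pField p (∇ v₂ x) - pField p (∇ v₁ x)) (∇ η x) ≤
        (‖∇ v₁ x‖ ^ (p - 1) + ‖∇ v₂ x‖ ^ (p - 1)) * ‖∇ η x‖ := by
      refine (real_inner_le_norm _ _).trans ?_
      gcongr
      refine (norm_sub_le _ _).trans ?_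
      rw [norm_pField hp, norm_pField hp, add_comm]
    have h2 := rpow_sub_one_mul_le hp (mul_nonneg hηx (norm_nonneg (∇ v₁ x)))
      (norm_nonneg (∇ η x)) hτ
    have h3 := rpow_sub_one_mul_le hp (mul_nonneg hηx (norm_nonneg (∇ v₂ x)))
      (norm_nonneg (∇ η x)) hτ
    rw [Real.mul_rpow hηx (norm_nonneg _), Real.mul_rpow hηx (norm_nonneg _)] at h2 h3
    calc p * η x ^ (p - 1) * Q x * inner ℝ (pField p (∇ v₂ x) - pField p (∇ v₁ x)) (∇ η x)
        ≤ p * η x ^ (p - 1) * Q x * ((‖∇ v₁ x‖ ^ (p - 1) + ‖∇ v₂ x‖ ^ (p - 1)) * ‖∇ η x‖) := by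
          gcongr
      _ = p * Q x * (η x ^ (p - 1) * ‖∇ v₁ x‖ ^ (p - 1) * ‖∇ η x‖ +
            η x ^ (p - 1) * ‖∇ v₂ x‖ ^ (p - 1) * ‖∇ η x‖) := by ring
      _ ≤ p * L * ((τ * (η x ^ p * ‖∇ v₁ x‖ ^ p) + τ ^ (1 - p) * ‖∇ η x‖ ^ p) +
            (τ * (η x ^ p * ‖∇ v₂ x‖ ^ p) + τ ^ (1 - p) * ‖∇ η x‖ ^ p)) := by gcongr
      _ = _ := by ring
  have iE₁ := (ig hg₁).mono_set hEΩ
  have iE₂ := (ig hg₂).mono_set hEΩ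
  have iEη := iη.mono_set hEΩ
  have hr : ∀ {F : EuclideanSpace ℝ (Fin N) → ℝ}, (∀ x ∈ Ω, x ∉ E → F x = 0) →
      ∫ x in E, F x = ∫ x in Ω, F x := fun h =>
    (setIntegral_eq_of_subset_of_forall_sdiff_eq_zero hΩ.measurableSet hEΩ
      fun x hx => h x hx.1 hx.2).symm
  calc ∫ x in E, (f₂ x - f₁ x) * (η x ^ p * Q x)
      = ∫ x in Ω, (f₂ x - f₁ x) * (η x ^ p * Q x) :=
        hr fun x hx hxE => by rw [hQE x hx hxE]; ring
    _ ≤ _ := key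
    _ ≤ ∫ x in Ω, p * η x ^ (p - 1) * Q x *
          inner ℝ (pField p (∇ v₂ x) - pField p (∇ v₁ x)) (∇ η x) :=
        setIntegral_mono_on (iφ (hA₂.sub hA₁)) iA hΩ.measurableSet hgrad
    _ = ∫ x in E, p * η x ^ (p - 1) * Q x *
          inner ℝ (pField p (∇ v₂ x) - pField p (∇ v₁ x)) (∇ η x) :=
        (hr fun x hx hxE => by rw [hQE x hx hxE]; ring).symm
    _ ≤ ∫ x in E, p * L * (τ * (η x ^ p * ‖∇ v₁ x‖ ^ p + η x ^ p * ‖∇ v₂ x‖ ^ p) +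
          2 * τ ^ (1 - p) * ‖∇ η x‖ ^ p) :=
        setIntegral_mono_on (iA.mono_set hEΩ)
          ((((iE₁.add iE₂).const_mul τ).add (iEη.const_mul _)).const_mul _) hEm hbound
    _ = _ := by
        have i12 : IntegrableOn (fun x => τ * (η x ^ p * ‖∇ v₁ x‖ ^ p + η x ^ p * ‖∇ v₂ x‖ ^ p))
          E := (iE₁.add iE₂).const_mul τ
        rw [integral_const_mul, integral_add i12 (iEη.const_mul _),
          integral_const_mul, integral_const_mul, integral_add iE₁ iE₂]

/-- Comparison on a set `E ⊇ {v₁ > v₂ + κ}` for `-Δ_p v₁ ≤ f₁` and `-Δ_p v₂ ≥ f₂` with `f₁ < f₂`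
in `E`, in the presence of cutoff functions adapted to `E`. -/
theorem sub_le_of_cutoff (hΩ : IsOpen Ω) (hfin : volume Ω ≠ ⊤) {p κ k T s C M B : ℝ}
    (hp : 1 < p) (hs : 0 < s) (hC : 0 ≤ C)
    {v₁ v₂ f₁ f₂ : EuclideanSpace ℝ (Fin N) → ℝ}
    (hv₁ : ContDiffOn ℝ 1 v₁ Ω) (hv₂ : ContDiffOn ℝ 1 v₂ Ω)
    (hf₁ : ContinuousOn f₁ Ω) (hf₂ : ContinuousOn f₂ Ω)
    (hM₁ : ∀ x ∈ Ω, v₁ x ≤ M) (hM₂ : ∀ x ∈ Ω, -M ≤ v₂ x)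
    (hsub : ∀ φ, IsTestFunction 1 Ω φ → (∀ x, 0 ≤ φ x) →
      ∫ x in Ω, inner ℝ (pField p (∇ v₁ x)) (∇ φ x) ≤ ∫ x in Ω, f₁ x * φ x)
    (hsup : ∀ φ, IsTestFunction 1 Ω φ → (∀ x, 0 ≤ φ x) →
      ∫ x in Ω, f₂ x * φ x ≤ ∫ x in Ω, inner ℝ (pField p (∇ v₂ x)) (∇ φ x))
    (hfC : ∀ x ∈ Ω, k < v₁ x → f₁ x ≤ C) (hf0 : ∀ x ∈ Ω, v₂ x < T → 0 ≤ f₂ x)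
    {E : Set (EuclideanSpace ℝ (Fin N))} (hEm : MeasurableSet E) (hEΩ : E ⊆ Ω)
    (hκE : ∀ x ∈ Ω, κ < v₁ x - v₂ x → x ∈ E)
    (hE₁ : ∀ x ∈ E, k + s ≤ v₁ x) (hE₂ : ∀ x ∈ E, v₂ x ≤ T - s)
    (hlt : ∀ x ∈ E, f₁ x < f₂ x)
    {η : ℕ → EuclideanSpace ℝ (Fin N) → ℝ} (hη : ∀ n, IsTestFunction 1 Ω (η n))
    (hη0 : ∀ n x, 0 ≤ η n x) (hη1 : ∀ n x, η n x ≤ 1)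
    (hηB : ∀ᶠ n in atTop, ∫ x in Ω, ‖∇ (η n) x‖ ^ p ≤ B)
    (hηE : Tendsto (fun n => ∫ x in E, ‖∇ (η n) x‖ ^ p) atTop (𝓝 0))
    (hηv : Tendsto (fun n => volume (E ∩ {x | η n x < 1})) atTop (𝓝 0)) :
    ∀ x ∈ Ω, v₁ x - v₂ x ≤ κ := by
  have hp0 : p ≠ 0 := by linarith
  have hB0 : 0 ≤ B := by
    obtain ⟨n, hn⟩ := hηB.exists
    exact (integral_nonneg fun x => by positivity).trans hn
  -- On `{v₁ > k}` the source `f₁` is at most `C`, which is all the energy estimate needs.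
  obtain ⟨D₁, hD₁0, hD₁⟩ : ∃ D : ℝ, 0 ≤ D ∧ ∀ η, IsTestFunction 1 Ω η → (∀ x, 0 ≤ η x) →
      (∀ x, η x ≤ 1) → ∫ x in Ω ∩ {x | k + s ≤ v₁ x}, η x ^ p * ‖∇ v₁ x‖ ^ p ≤
        D * (1 + ∫ x in Ω, ‖∇ η x‖ ^ p) := by
    refine caccioppoli hΩ hfin hp hC hs hv₁ hM₁ fun φ hφ hφ0 hφk => ?_
    refine (hsub φ hφ hφ0).trans ?_
    have iφ : IntegrableOn φ Ω :=
      (hφ.1.continuous.integrable_of_hasCompactSupport hφ.2.1).integrableOn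
    rw [← integral_const_mul]
    refine setIntegral_mono_on ?_ (iφ.const_mul C) hΩ.measurableSet fun x hx => ?_
    · refine hφ.integrableOn hΩ (hf₁.mul hφ.1.continuous.continuousOn) fun x _ hx => ?_
      rw [image_eq_zero_of_notMem_tsupport hx, mul_zero]
    · rcases le_or_gt (v₁ x) k with h | h
      · rw [hφk x hx h]; simp
      · exact mul_le_mul_of_nonneg_right (hfC x hx h) (hφ0 x)
  -- The field is odd, so `-v₂` is a subsolution with zero source on `{-v₂ > -T}`, where `f₂ ≥ 0`.
  obtain ⟨D₂, hD₂0, hD₂⟩ : ∃ D : ℝ, 0 ≤ D ∧ ∀ η, IsTestFunction 1 Ω η → (∀ x, 0 ≤ η x) →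
      (∀ x, η x ≤ 1) → ∫ x in Ω ∩ {x | -T + s ≤ -v₂ x}, η x ^ p * ‖∇ (fun y => -v₂ y) x‖ ^ p ≤
        D * (1 + ∫ x in Ω, ‖∇ η x‖ ^ p) := by
    refine caccioppoli hΩ hfin hp le_rfl hs hv₂.neg (M := M)
      (fun x hx => by linarith [hM₂ x hx]) fun φ hφ hφ0 hφk => ?_
    simp only [gradient_neg, pField_neg, inner_neg_left, zero_mul, integral_neg]
    have h1 : 0 ≤ ∫ x in Ω, f₂ x * φ x := by
      refine setIntegral_nonneg hΩ.measurableSet fun x hx => ?_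
      rcases lt_or_ge (v₂ x) T with h | h
      · exact mul_nonneg (hf0 x hx h) (hφ0 x)
      · rw [hφk x hx (by linarith)]; simp
    linarith [hsup φ hφ hφ0]
  have hηp : ∀ n, Continuous fun x => η n x ^ p := fun n =>
    (hη n).1.continuous.rpow_const fun _ => Or.inr (by linarith)
  have henergy : ∀ (n : ℕ) {v : EuclideanSpace ℝ (Fin N) → ℝ}
      {E' : Set (EuclideanSpace ℝ (Fin N))}, ContinuousOn (∇ v) Ω → E ⊆ E' → E' ⊆ Ω →
      ∫ x in E, η n x ^ p * ‖∇ v x‖ ^ p ≤ ∫ x in E', η n x ^ p * ‖∇ v x‖ ^ p := by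
    intro n v E' hv h1 h2
    have i : IntegrableOn (fun x => η n x ^ p * ‖∇ v x‖ ^ p) Ω := by
      refine (hη n).integrableOn hΩ ((hηp n).continuousOn.mul (hv.norm.rpow_const
        fun _ _ => Or.inr (by linarith))) fun x _ hx => ?_
      rw [image_eq_zero_of_notMem_tsupport hx, Real.zero_rpow hp0, zero_mul]
    refine setIntegral_mono_set (i.mono_set h2) ?_ h1.eventuallyLE
    refine Eventually.of_forall fun x => ?_
    have := hη0 n x
    simp only [Pi.zero_apply]; positivity
  have hen₁ : ∀ᶠ n in atTop, ∫ x in E, η n x ^ p * ‖∇ v₁ x‖ ^ p ≤ D₁ * (1 + B) := by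
    filter_upwards [hηB] with n hn
    refine (henergy n (E' := Ω ∩ {x | k + s ≤ v₁ x}) (hv₁.continuousOn_gradient hΩ) (fun x hx => ⟨hEΩ hx, hE₁ x hx⟩)
      Set.inter_subset_left).trans ((hD₁ _ (hη n) (hη0 n) (hη1 n)).trans ?_)
    gcongr
  have hen₂ : ∀ᶠ n in atTop, ∫ x in E, η n x ^ p * ‖∇ v₂ x‖ ^ p ≤ D₂ * (1 + B) := by
    filter_upwards [hηB] with n hn
    have h := hD₂ _ (hη n) (hη0 n) (hη1 n)
    simp only [gradient_neg, norm_neg] at h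
    refine (henergy n (E' := Ω ∩ {x | -T + s ≤ -v₂ x}) (hv₂.continuousOn_gradient hΩ) (fun x hx => ⟨hEΩ hx, ?_⟩)
      Set.inter_subset_left).trans (h.trans ?_)
    · show -T + s ≤ -v₂ x
      linarith [hE₂ x hx]
    · gcongr
  -- the right-hand sides separate on a ball around a point with `v₁ - v₂ > κ`
  intro x₀ hx₀
  by_contra! hcon
  set W : EuclideanSpace ℝ (Fin N) → ℝ :=
    fun x => (f₂ x - f₁ x) * max (v₁ x - v₂ x - κ) 0 ^ 2 with hW
  have hvc : ContinuousOn (fun x => v₁ x - v₂ x) Ω := hv₁.continuousOn.sub hv₂.continuousOn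
  have hmc : Continuous fun t : ℝ => max (t - κ) 0 ^ 2 := by fun_prop
  have hWc : ContinuousOn W Ω := (hf₂.sub hf₁).mul (hmc.comp_continuousOn hvc)
  have hW₀ : 0 < W x₀ := by
    have h1 := hlt x₀ (hκE x₀ hx₀ hcon)
    have h2 : 0 < max (v₁ x₀ - v₂ x₀ - κ) 0 := lt_max_of_lt_left (by linarith)
    have h3 : 0 < f₂ x₀ - f₁ x₀ := by linarith
    positivity
  have hWE0 : ∀ x ∈ E, 0 ≤ W x := fun x hx =>
    mul_nonneg (by linarith [hlt x hx]) (sq_nonneg _)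
  set m := W x₀ / 2 with hm
  have hm0 : 0 < m := by positivity
  set U := Ω ∩ {x | κ < v₁ x - v₂ x} ∩ (Ω ∩ {x | m < W x}) with hU
  have hUo : IsOpen U := (hvc.isOpen_inter_preimage hΩ isOpen_Ioi).inter
    (hWc.isOpen_inter_preimage hΩ isOpen_Ioi)
  have hUx : x₀ ∈ U := ⟨⟨hx₀, hcon⟩, hx₀, by show m < W x₀; linarith⟩
  have hUE : U ⊆ E := fun x hx => hκE x hx.1.1 hx.1.2
  have hUfin : volume U ≠ ⊤ := measure_ne_top_of_subset (hUE.trans hEΩ) hfin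
  have hUpos : 0 < volume.real U :=
    ENNReal.toReal_pos (hUo.measure_pos volume ⟨x₀, hUx⟩).ne' hUfin
  have hlower : ∀ n, m * (volume.real U - volume.real (E ∩ {x | η n x < 1})) ≤
      ∫ x in E, (f₂ x - f₁ x) * (η n x ^ p * max (v₁ x - v₂ x - κ) 0 ^ 2) := by
    intro n
    have hVm : MeasurableSet (U ∩ {x | 1 ≤ η n x}) :=
      hUo.measurableSet.inter (isClosed_le continuous_const (hη n).1.continuous).measurableSet
    have iW : IntegrableOn (fun x => (f₂ x - f₁ x) *
        (η n x ^ p * max (v₁ x - v₂ x - κ) 0 ^ 2)) Ω := by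
      refine (hη n).integrableOn hΩ ((hf₂.sub hf₁).mul ((hηp n).continuousOn.mul
        (hmc.comp_continuousOn hvc))) fun x _ hx => ?_
      rw [image_eq_zero_of_notMem_tsupport hx, Real.zero_rpow hp0]; ring
    have hVE : U ∩ {x | 1 ≤ η n x} ⊆ E := Set.inter_subset_left.trans hUE
    have hvol : volume.real U - volume.real (E ∩ {x | η n x < 1}) ≤
        volume.real (U ∩ {x | 1 ≤ η n x}) := by
      have h1 : U ⊆ (U ∩ {x | 1 ≤ η n x}) ∪ (E ∩ {x | η n x < 1}) := fun x hx => by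
        rcases le_or_gt 1 (η n x) with h | h
        · exact Or.inl ⟨hx, h⟩
        · exact Or.inr ⟨hUE hx, h⟩
      have h2 : volume.real U ≤ _ := measureReal_mono h1 (measure_union_ne_top
        (measure_ne_top_of_subset (hVE.trans hEΩ) hfin)
        (measure_ne_top_of_subset (Set.inter_subset_left.trans hEΩ) hfin))
      linarith [measureReal_union_le (μ := volume) (U ∩ {x | 1 ≤ η n x}) (E ∩ {x | η n x < 1})]
    calc m * (volume.real U - volume.real (E ∩ {x | η n x < 1}))
        ≤ m * volume.real (U ∩ {x | 1 ≤ η n x}) := by gcongr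
      _ = ∫ x in U ∩ {x | 1 ≤ η n x}, m := by rw [setIntegral_const, smul_eq_mul, mul_comm]
      _ ≤ ∫ x in U ∩ {x | 1 ≤ η n x}, (f₂ x - f₁ x) *
            (η n x ^ p * max (v₁ x - v₂ x - κ) 0 ^ 2) := by
          refine setIntegral_mono_on (integrableOn_const
            (measure_ne_top_of_subset (hVE.trans hEΩ) hfin)) (iW.mono_set (hVE.trans hEΩ)) hVm
            fun x hx => ?_
          have h1 : η n x = 1 := le_antisymm (hη1 n x) hx.2
          have h2 : m < W x := hx.1.2.2
          rw [h1, Real.one_rpow, one_mul]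
          exact h2.le
      _ ≤ _ := by
          refine setIntegral_mono_set (iW.mono_set hEΩ) ?_ hVE.eventuallyLE
          refine (ae_restrict_iff' hEm).2 (Eventually.of_forall fun x hx => ?_)
          have h1 : 0 ≤ η n x ^ p := Real.rpow_nonneg (hη0 n x) _
          have h2 := mul_nonneg h1 (hWE0 x hx)
          simp only [Pi.zero_apply]
          calc 0 ≤ _ := h2
            _ = _ := by rw [hW]; ring
  set L : ℝ := (|2 * M - κ|) ^ 2 with hL
  have hLE : ∀ x ∈ E, max (v₁ x - v₂ x - κ) 0 ^ 2 ≤ L := fun x hx => by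
    refine pow_le_pow_left₀ (le_max_right _ _) (max_le ?_ (abs_nonneg _)) 2
    have := hM₁ x (hEΩ hx)
    have := hM₂ x (hEΩ hx)
    exact le_trans (by linarith) (le_abs_self _)
  have hL0 : 0 ≤ L := by positivity
  have hvol0 : Tendsto (fun n => volume.real (E ∩ {x | η n x < 1})) atTop (𝓝 0) := by
    have := (ENNReal.tendsto_toReal ENNReal.zero_ne_top).comp hηv
    rwa [ENNReal.toReal_zero] at this
  -- With `τ` fixed, letting `n → ∞` kills the factor `τ^(1-p)`, which blows up as `τ → 0`; hence
  -- the order of the limits.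
  have hlim : ∀ τ : ℝ, 0 < τ →
      m * volume.real U ≤ p * L * (τ * (D₁ * (1 + B) + D₂ * (1 + B))) := by
    intro τ hτ
    have hl : Tendsto (fun n => m * (volume.real U - volume.real (E ∩ {x | η n x < 1}))) atTop
        (𝓝 (m * (volume.real U - 0))) := (tendsto_const_nhds.sub hvol0).const_mul m
    have hr : Tendsto (fun n => p * L * (τ * (D₁ * (1 + B) + D₂ * (1 + B)) +
        2 * τ ^ (1 - p) * ∫ x in E, ‖∇ (η n) x‖ ^ p)) atTop
        (𝓝 (p * L * (τ * (D₁ * (1 + B) + D₂ * (1 + B)) + 2 * τ ^ (1 - p) * 0))) :=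
      (tendsto_const_nhds.add (hηE.const_mul _)).const_mul _
    rw [sub_zero] at hl
    rw [mul_zero, add_zero] at hr
    refine le_of_tendsto_of_tendsto hl hr ?_
    filter_upwards [hen₁, hen₂] with n h1 h2
    refine (hlower n).trans ((integral_sub_mul_le_of_sub_super hΩ hp hτ hv₁ hv₂ hf₁ hf₂ hsub hsup
      hEm hEΩ hκE hLE (hη n) (hη0 n)).trans ?_)
    gcongr
  set Z := p * L * (D₁ * (1 + B) + D₂ * (1 + B)) with hZ
  have hZ0 : 0 ≤ Z := by positivity
  have hmU : 0 < m * volume.real U := by positivity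
  -- This `τ` makes the right side `m |U|` times `Z / (2 (Z + 1)) < 1`, a contradiction. The `+ 1`
  -- covers `Z = 0`.
  have := hlim (m * volume.real U / (2 * (Z + 1))) (by positivity)
  have h2 : p * L * (m * volume.real U / (2 * (Z + 1)) * (D₁ * (1 + B) + D₂ * (1 + B))) =
      m * volume.real U * (Z / (2 * (Z + 1))) := by
    rw [hZ]; ring
  rw [h2] at this
  have h3 : Z / (2 * (Z + 1)) < 1 := by
    rw [div_lt_one (by positivity)]; linarith
  nlinarith

end Core

/-! ### Pointwise consequences of continuity, and the change of unknown -/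

section Transformation

variable {N : ℕ} {Ω : Set (EuclideanSpace ℝ (Fin N))}

/-- The set where the bound fails is open and null, hence empty. -/
lemma ContinuousOn.le_of_ae_restrict_le {f : EuclideanSpace ℝ (Fin N) → ℝ} (hΩ : IsOpen Ω)
    (hf : ContinuousOn f Ω) {C : ℝ} (h : ∀ᵐ x ∂(volume.restrict Ω), f x ≤ C) :
    ∀ x ∈ Ω, f x ≤ C := by
  have ho : IsOpen (Ω ∩ f ⁻¹' Set.Ioi C) := hf.isOpen_inter_preimage hΩ isOpen_Ioi
  have h0 : volume (Ω ∩ f ⁻¹' Set.Ioi C) = 0 := by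
    rw [ae_restrict_iff' hΩ.measurableSet] at h
    refine measure_mono_null (fun x hx => ?_) h
    simp only [Set.mem_compl_iff]
    intro hx'
    exact absurd (hx' hx.1) (not_le.2 hx.2)
  intro x hx
  by_contra! hlt
  have : x ∈ Ω ∩ f ⁻¹' Set.Ioi C := ⟨hx, hlt⟩
  rw [ho.measure_eq_zero_iff volume |>.1 h0] at this
  exact this

lemma EssPositive.pos {u : EuclideanSpace ℝ (Fin N) → ℝ} (hΩ : IsOpen Ω)
    (hu : ContinuousOn u Ω) (h : EssPositive Ω u) : ∀ x ∈ Ω, 0 < u x := by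
  intro x hx
  obtain ⟨r, hr, hrΩ⟩ := Metric.nhds_basis_closedBall.mem_iff.1 (hΩ.mem_nhds hx)
  obtain ⟨δ, hδ, hδu⟩ := h _ (isCompact_closedBall x r) hrΩ
  have h1 : ∀ᵐ y ∂(volume.restrict (Metric.ball x r)), -u y ≤ -δ := by
    filter_upwards [ae_restrict_of_ae_restrict_of_subset Metric.ball_subset_closedBall hδu]
      with y hy using neg_le_neg hy
  have h2 := ContinuousOn.le_of_ae_restrict_le Metric.isOpen_ball
    ((hu.mono (Metric.ball_subset_closedBall.trans hrΩ)).neg) h1 x (Metric.mem_ball_self hr)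
  simp only [Pi.neg_apply] at h2
  linarith

lemma exists_abs_le_of_memLp_top {u : EuclideanSpace ℝ (Fin N) → ℝ} (hΩ : IsOpen Ω)
    (hu : ContinuousOn u Ω) (h : MemLp u ⊤ (volume.restrict Ω)) :
    ∃ M : ℝ, ∀ x ∈ Ω, |u x| ≤ M := by
  refine ⟨(eLpNorm u ⊤ (volume.restrict Ω)).toReal,
    ContinuousOn.le_of_ae_restrict_le hΩ hu.abs ?_⟩
  filter_upwards [ae_le_eLpNormEssSup (f := u) (μ := volume.restrict Ω)] with x hx
  rw [← eLpNorm_exponent_top] at hx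
  have := ENNReal.toReal_mono h.eLpNorm_ne_top hx
  simpa using this

/-- Taking the primitive as an integral covers `a = 0`, that is `ϑ = 0`, without a separate formula.
-/
lemma exists_hasDerivAt_exp_neg_mul (a : ℝ) :
    ∃ g : ℝ → ℝ, ∀ t, HasDerivAt g (Real.exp (-(a * t))) t := by
  have hc : Continuous fun s : ℝ => Real.exp (-(a * s)) := by fun_prop
  exact ⟨fun t => ∫ s in (0 : ℝ)..t, Real.exp (-(a * s)),
    fun t => (hc.integral_hasStrictDerivAt 0 t).hasDerivAt⟩

/-- The change of unknown `v = g(u)` with `g' = exp (-ϑ t / (p - 1))` absorbs the term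
`ϑ |∇u|^p`. -/
lemma integral_inner_pField_gradient_comp (hΩ : IsOpen Ω) {p ϑ : ℝ} (hp : 1 < p)
    {u : EuclideanSpace ℝ (Fin N) → ℝ} (hu : ContDiffOn ℝ 1 u Ω) {g : ℝ → ℝ}
    (hg : ∀ t, HasDerivAt g (Real.exp (-(ϑ / (p - 1) * t))) t)
    {φ : EuclideanSpace ℝ (Fin N) → ℝ} (hφ : IsTestFunction 1 Ω φ) :
    ∫ x in Ω, inner ℝ (pField p (∇ (fun y => g (u y)) x)) (∇ φ x) =
      (∫ x in Ω, ‖∇ u x‖ ^ (p - 2) *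
        inner ℝ (∇ u x) (∇ (fun y => φ y * Real.exp (-(ϑ * u y))) x)) +
        ϑ * ∫ x in Ω, ‖∇ u x‖ ^ p * (φ x * Real.exp (-(ϑ * u x))) := by
  have hgu := hu.continuousOn_gradient hΩ
  have hA : ContinuousOn (fun x => pField p (∇ u x)) Ω :=
    (continuous_pField hp).comp_continuousOn hgu
  have he : ContDiffOn ℝ 1 (fun y => Real.exp (-(ϑ * u y))) Ω := (contDiffOn_const.mul hu).neg.exp
  have hψ : IsTestFunction 1 Ω (fun y => φ y * Real.exp (-(ϑ * u y))) := hφ.mul hΩ he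
  have hin : ∀ ζ ξ : EuclideanSpace ℝ (Fin N),
      ‖ζ‖ ^ (p - 2) * inner ℝ ζ ξ = inner ℝ (pField p ζ) ξ := fun ζ ξ => by
    rw [pField, real_inner_smul_left]
  simp only [hin]
  have i1 : IntegrableOn (fun x => inner ℝ (pField p (∇ u x))
      (∇ (fun y => φ y * Real.exp (-(ϑ * u y))) x)) Ω := by
    refine hψ.integrableOn hΩ (hA.inner hψ.1.continuous_gradient.continuousOn) fun x _ hx => ?_
    rw [gradient_eq_zero_of_notMem_tsupport hx, inner_zero_right]
  have i2 : IntegrableOn (fun x => ‖∇ u x‖ ^ p * (φ x * Real.exp (-(ϑ * u x)))) Ω := by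
    refine hψ.integrableOn hΩ ((hgu.norm.rpow_const fun _ _ => Or.inr (by linarith)).mul
      hψ.1.continuous.continuousOn) fun x _ hx => ?_
    rw [image_eq_zero_of_notMem_tsupport (f := fun y => φ y * Real.exp (-(ϑ * u y))) hx, mul_zero]
  rw [← integral_const_mul, ← integral_add i1 (i2.const_mul ϑ)]
  refine setIntegral_congr_fun hΩ.measurableSet fun x hx => ?_
  have hd : DifferentiableAt ℝ u x :=
    (hu.differentiableOn one_ne_zero).differentiableAt (hΩ.mem_nhds hx)
  have hde : HasDerivAt (fun t => Real.exp (-(ϑ * t))) (-ϑ * Real.exp (-(ϑ * u x))) (u x) := by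
    have := ((hasDerivAt_id (u x)).const_mul ϑ).fun_neg.exp
    simpa [mul_comm] using this
  have hep : Real.exp (-(ϑ / (p - 1) * u x)) ^ (p - 1) = Real.exp (-(ϑ * u x)) := by
    rw [← Real.exp_mul]
    congr 1
    have : p - 1 ≠ 0 := by linarith
    field_simp
  -- Differentiating the weight `exp (-ϑ u)` produces `-ϑ |∇u|^p φ exp (-ϑ u)`, which cancels the
  -- added gradient term.
  rw [gradient_comp (hg (u x)) hd, pField_smul (Real.exp_pos _), hep,
    gradient_mul (g := fun y => Real.exp (-(ϑ * u y))) (hφ.1.differentiable one_ne_zero x)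
      (hde.differentiableAt.comp x hd),
    gradient_comp hde hd, inner_add_right, real_inner_smul_right, real_inner_smul_right,
    real_inner_smul_right, inner_pField_self hp, real_inner_smul_left]
  ring

lemma integral_reaction_eq (hΩ : IsOpen Ω) {γ ϑ c : ℝ}
    {u : EuclideanSpace ℝ (Fin N) → ℝ} (hu : ContDiffOn ℝ 1 u Ω) (hpos : ∀ x ∈ Ω, 0 < u x)
    {φ : EuclideanSpace ℝ (Fin N) → ℝ} (hφ : IsTestFunction 1 Ω φ) :
    ∫ x in Ω, Real.exp (-(ϑ * u x)) * (c / u x ^ γ - ϑ) * φ x =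
      (∫ x in Ω, c / u x ^ γ * (φ x * Real.exp (-(ϑ * u x)))) -
        ϑ * ∫ x in Ω, φ x * Real.exp (-(ϑ * u x)) := by
  have he : ContDiffOn ℝ 1 (fun y => Real.exp (-(ϑ * u y))) Ω := (contDiffOn_const.mul hu).neg.exp
  have hψ : IsTestFunction 1 Ω (fun y => φ y * Real.exp (-(ϑ * u y))) := hφ.mul hΩ he
  have hc : ContinuousOn (fun x => c / u x ^ γ) Ω :=
    continuousOn_const.div (hu.continuousOn.rpow_const fun x hx => Or.inl (hpos x hx).ne')
      fun x hx => (Real.rpow_pos_of_pos (hpos x hx) _).ne'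
  have i1 : IntegrableOn (fun x => c / u x ^ γ * (φ x * Real.exp (-(ϑ * u x)))) Ω := by
    refine hψ.integrableOn hΩ (hc.mul hψ.1.continuous.continuousOn) fun x _ hx => ?_
    rw [image_eq_zero_of_notMem_tsupport (f := fun y => φ y * Real.exp (-(ϑ * u y))) hx, mul_zero]
  have i2 : IntegrableOn (fun x => φ x * Real.exp (-(ϑ * u x))) Ω :=
    (hψ.1.continuous.integrable_of_hasCompactSupport hψ.2.1).integrableOn
  rw [← integral_const_mul, ← integral_sub i1 (i2.const_mul ϑ)]
  congr 1
  ext x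
  ring

end Transformation

/-! ### The comparison principle -/

theorem lemma2p3 {N : ℕ} (hN : 1 ≤ N) (Ω : Set (EuclideanSpace ℝ (Fin N)))
    (hΩo : IsOpen Ω) (hΩb : Bornology.IsBounded Ω)
    (p γ ϑ c α : ℝ) (hp : 1 < p) (hγ : 0 < γ) (hϑ : 0 ≤ ϑ) (hc : 0 < c)
    (hα0 : 0 < α) (hα1 : α < 1)
    (u₁ u₂ : EuclideanSpace ℝ (Fin N) → ℝ)
    (hu₁ : IsC1HolderLoc α Ω u₁) (hu₂ : IsC1HolderLoc α Ω u₂)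
    (hb₁ : MemLp u₁ ∞ (volume.restrict Ω)) (hb₂ : MemLp u₂ ∞ (volume.restrict Ω))
    (hpos₁ : EssPositive Ω u₁) (hpos₂ : EssPositive Ω u₂)
    (hsub : IsWeakSubsolution p γ ϑ c Ω u₁)
    (hsup : IsWeakSupersolution p γ ϑ c Ω u₂)
    (hbdry : BoundaryLE p Ω u₁ u₂)
    (hle : 0 < ϑ → ∀ x ∈ Ω, u₁ x ≤ (c / ϑ) ^ (1 / γ)) :
    ∀ x ∈ Ω, u₁ x ≤ u₂ x := by
  have hC₁ := hu₁.1
  have hC₂ := hu₂.1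
  have hfin : volume Ω ≠ ⊤ := hΩb.measure_lt_top.ne
  have h0₁ := hpos₁.pos hΩo hC₁.continuousOn
  have h0₂ := hpos₂.pos hΩo hC₂.continuousOn
  obtain ⟨M₁, hM₁⟩ := exists_abs_le_of_memLp_top hΩo hC₁.continuousOn hb₁
  obtain ⟨M₂, hM₂⟩ := exists_abs_le_of_memLp_top hΩo hC₂.continuousOn hb₂
  -- A cap for `u₁` below which the reaction is nonnegative: the assumed bound if `ϑ > 0`, any upper
  -- bound for `u₁` if `ϑ = 0`.
  obtain ⟨L, hL, hLϑ⟩ : ∃ L : ℝ, (∀ x ∈ Ω, u₁ x ≤ L) ∧ ∀ t, 0 < t → t ≤ L → ϑ ≤ c / t ^ γ := by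
    rcases hϑ.eq_or_lt with h | h
    · exact ⟨M₁, fun x hx => (le_abs_self _).trans (hM₁ x hx), fun t ht _ => by
        rw [← h]; positivity⟩
    · refine ⟨_, hle h, fun t ht htL => ?_⟩
      have h1 : t ^ γ ≤ c / ϑ := by
        have := Real.rpow_le_rpow ht.le htL hγ.le
        rwa [← Real.rpow_mul (by positivity), one_div_mul_cancel hγ.ne', Real.rpow_one] at this
      rw [le_div_iff₀ (by positivity)]
      rw [le_div_iff₀ h] at h1
      linarith
  obtain ⟨g, hg⟩ := exists_hasDerivAt_exp_neg_mul (ϑ / (p - 1))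
  have hgC : ContDiff ℝ 1 g := by
    rw [contDiff_one_iff_deriv]
    refine ⟨fun t => (hg t).differentiableAt, ?_⟩
    rw [show deriv g = fun t => Real.exp (-(ϑ / (p - 1) * t)) from funext fun t => (hg t).deriv]
    fun_prop
  have hgm : StrictMono g := strictMono_of_deriv_pos fun t => by
    rw [(hg t).deriv]; positivity
  have hgLip : ∀ s t, 0 < s → s ≤ t → g t - g s ≤ t - s := by
    intro s t hs hst
    have := (convex_Ici s).image_sub_le_mul_sub_of_deriv_le (f := g) (C := 1)
      hgC.continuous.continuousOn (fun x _ => (hg x).differentiableAt.differentiableWithinAt)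
      (fun x hx => by
        rw [interior_Ici] at hx
        have hx0 : 0 < x := hs.trans hx
        have hp1 : 0 < p - 1 := by linarith
        rw [(hg x).deriv, Real.exp_le_one_iff]
        have : 0 ≤ ϑ / (p - 1) * x := by positivity
        linarith) s Set.self_mem_Ici t hst hst
    linarith
  set v₁ : EuclideanSpace ℝ (Fin N) → ℝ := fun x => g (u₁ x) with hv₁
  set v₂ : EuclideanSpace ℝ (Fin N) → ℝ := fun x => g (u₂ x) with hv₂
  set f₁ : EuclideanSpace ℝ (Fin N) → ℝ :=
    fun x => Real.exp (-(ϑ * u₁ x)) * (c / u₁ x ^ γ - ϑ) with hf₁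
  set f₂ : EuclideanSpace ℝ (Fin N) → ℝ :=
    fun x => Real.exp (-(ϑ * u₂ x)) * (c / u₂ x ^ γ - ϑ) with hf₂
  have hfc : ∀ {u : EuclideanSpace ℝ (Fin N) → ℝ}, ContinuousOn u Ω → (∀ x ∈ Ω, 0 < u x) →
      ContinuousOn (fun x => Real.exp (-(ϑ * u x)) * (c / u x ^ γ - ϑ)) Ω := fun hu h0 =>
    (continuousOn_const.mul hu).neg.rexp.mul ((continuousOn_const.div
      (hu.rpow_const fun x hx => Or.inl (h0 x hx).ne')
      fun x hx => (Real.rpow_pos_of_pos (h0 x hx) _).ne').sub continuousOn_const)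
  have htest : ∀ {u φ : EuclideanSpace ℝ (Fin N) → ℝ}, ContDiffOn ℝ 1 u Ω →
      IsTestFunction 1 Ω φ → IsTestFunction 1 Ω (fun y => φ y * Real.exp (-(ϑ * u y))) :=
    fun hu hφ => hφ.mul hΩo (contDiffOn_const.mul hu).neg.exp
  have hsub' : ∀ φ, IsTestFunction 1 Ω φ → (∀ x, 0 ≤ φ x) →
      ∫ x in Ω, inner ℝ (pField p (∇ v₁ x)) (∇ φ x) ≤ ∫ x in Ω, f₁ x * φ x := by
    intro φ hφ hφ0
    have h := hsub _ (htest hC₁ hφ) fun x => mul_nonneg (hφ0 x) (Real.exp_pos _).le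
    rw [integral_inner_pField_gradient_comp hΩo hp hC₁ hg hφ, integral_reaction_eq hΩo hC₁ h0₁ hφ]
    linarith
  have hsup' : ∀ φ, IsTestFunction 1 Ω φ → (∀ x, 0 ≤ φ x) →
      ∫ x in Ω, f₂ x * φ x ≤ ∫ x in Ω, inner ℝ (pField p (∇ v₂ x)) (∇ φ x) := by
    intro φ hφ hφ0
    have h := hsup _ (htest hC₂ hφ) fun x => mul_nonneg (hφ0 x) (Real.exp_pos _).le
    rw [integral_inner_pField_gradient_comp hΩo hp hC₂ hg hφ, integral_reaction_eq hΩo hC₂ h0₂ hφ]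
    linarith
  have hmain : ∀ ε : ℝ, 0 < ε → ∀ x ∈ Ω, v₁ x - v₂ x ≤ 2 * ε := by
    intro ε hε
    have huc : ContinuousOn (fun x => u₁ x - u₂ x) Ω := hC₁.continuousOn.sub hC₂.continuousOn
    have hwc : ContinuousOn (fun x => max (u₁ x - u₂ x - ε) 0) Ω :=
      (show Continuous fun t : ℝ => max (t - ε) 0 by fun_prop).comp_continuousOn huc
    -- With `δ = ε / 2`, the set `{w > 2δ}` is `{u₁ - u₂ > 2ε}`.
    obtain ⟨η, B, hη, hη0, hη1, hηB, hηE, hηv⟩ :=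
      (hbdry ε hε).exists_cutoff hΩo hp (half_pos hε) hwc
    have hEmem : ∀ x ∈ Ω ∩ {x | 2 * (ε / 2) < max (u₁ x - u₂ x - ε) 0}, u₂ x + 2 * ε < u₁ x := by
      rintro x ⟨-, hx⟩
      simp only [Set.mem_ofPred_eq, lt_max_iff] at hx
      rcases hx with hx | hx <;> linarith
    have hs₁ : 0 < g (2 * ε) - g ε := sub_pos.2 (hgm (by linarith))
    have hs₂ : 0 < g L - g (L - 2 * ε) := sub_pos.2 (hgm (by linarith))
    -- On `E`, `u₁ > 2ε` because `u₂ > 0`, and `u₂ < L - 2ε` because `u₁ ≤ L`. The levels `g ε` and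
    -- `g L` thus leave a gap on both sides, and `s` is the smaller one.
    refine sub_le_of_cutoff hΩo hfin (k := g ε) (T := g L)
      (s := min (g (2 * ε) - g ε) (g L - g (L - 2 * ε))) (C := c / ε ^ γ)
      (M := |g M₁| + |g (-M₂)|) hp (lt_min hs₁ hs₂) (by positivity)
      (hgC.comp_contDiffOn hC₁) (hgC.comp_contDiffOn hC₂) (hfc hC₁.continuousOn h0₁)
      (hfc hC₂.continuousOn h0₂) ?_ ?_ hsub' hsup' ?_ ?_
      (hwc.isOpen_inter_preimage hΩo isOpen_Ioi).measurableSet Set.inter_subset_left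
      ?_ ?_ ?_ ?_ hη hη0 hη1 hηB hηE hηv
    · intro x hx
      have h1 : g (u₁ x) ≤ g M₁ := hgm.monotone ((le_abs_self _).trans (hM₁ x hx))
      linarith [le_abs_self (g M₁), abs_nonneg (g (-M₂))]
    · intro x hx
      have h1 : g (-M₂) ≤ g (u₂ x) := hgm.monotone (neg_le_of_abs_le (hM₂ x hx))
      show _ ≤ g (u₂ x)
      linarith [neg_abs_le (g (-M₂)), abs_nonneg (g M₁)]
    · intro x hx hk
      have hε₁ : ε < u₁ x := hgm.lt_iff_lt.1 hk
      have h0 := h0₁ x hx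
      have h1 : c / u₁ x ^ γ ≤ c / ε ^ γ := by gcongr
      have h2 : Real.exp (-(ϑ * u₁ x)) ≤ 1 := by
        rw [Real.exp_le_one_iff]
        have : 0 ≤ ϑ * u₁ x := by positivity
        linarith
      have h3 : 0 ≤ c / u₁ x ^ γ - ϑ := sub_nonneg.2 (hLϑ _ h0 (hL x hx))
      calc f₁ x ≤ 1 * (c / u₁ x ^ γ - ϑ) := by
            simp only [hf₁]; gcongr
        _ ≤ c / ε ^ γ := by linarith
    · intro x hx hT
      have h1 : u₂ x < L := hgm.lt_iff_lt.1 hT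
      exact mul_nonneg (Real.exp_pos _).le (sub_nonneg.2 (hLϑ _ (h0₂ x hx) h1.le))
    -- Since `g' ≤ 1` on positive values, `v₁ - v₂ > 2ε` forces `u₁ - u₂ > 2ε`.
    · intro x hx hκ
      refine ⟨hx, (lt_max_of_lt_left ?_ : 2 * (ε / 2) < max (u₁ x - u₂ x - ε) 0)⟩
      rcases le_total (u₂ x) (u₁ x) with h | h
      · have := hgLip _ _ (h0₂ x hx) h
        simp only [hv₁, hv₂] at hκ
        linarith
      · have := hgm.monotone h
        simp only [hv₁, hv₂] at hκ
        linarith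
    · intro x hx
      have h1 : g (2 * ε) ≤ g (u₁ x) := hgm.monotone (by linarith [hEmem x hx, h0₂ x hx.1])
      show _ ≤ g (u₁ x)
      linarith [min_le_left (g (2 * ε) - g ε) (g L - g (L - 2 * ε))]
    · intro x hx
      have h1 : g (u₂ x) ≤ g (L - 2 * ε) := hgm.monotone (by linarith [hEmem x hx, hL x hx.1])
      show g (u₂ x) ≤ _
      linarith [min_le_right (g (2 * ε) - g ε) (g L - g (L - 2 * ε))]
    -- The exponential factor may be enlarged because the other factor is nonnegative at `u₁`;
    -- strictness comes from `c / t^γ`.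
    · intro x hx
      have h1 := h0₁ x hx.1
      have h2 := h0₂ x hx.1
      have h12 : u₂ x < u₁ x := by linarith [hEmem x hx]
      have h3 : c / u₁ x ^ γ < c / u₂ x ^ γ := by gcongr
      have h4 : 0 ≤ c / u₁ x ^ γ - ϑ := sub_nonneg.2 (hLϑ _ h1 (hL x hx.1))
      calc f₁ x ≤ Real.exp (-(ϑ * u₂ x)) * (c / u₁ x ^ γ - ϑ) := by
            simp only [hf₁]; gcongr
        _ < f₂ x := by simp only [hf₂]; gcongr
  intro x hx
  refine hgm.le_iff_le.1 (le_of_forall_pos_le_add fun ε hε => ?_)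
  have := hmain (ε / 2) (half_pos hε) x hx
  simp only [hv₁, hv₂] at this
  linarith
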